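/- Let $\mathbb{B}$ be the commutative associative algebra over $\mathbb{C}$ with basis $e_1=1,\ e_2$ and multiplication $e_2^2=e_1+2ie_2$ (so that $(e_1^2+e_2^2)^2=0$, $e_1^2+e_2^2\neq 0$), with the norm $\|z_1e_1+z_2e_2\|=\sqrt{|z_1|^2+|z_2|^2}$ for $z_1,z_2\in\mathbb{C}$. Let $\mu=\{xe_1+ye_2 : x,y\in\mathbb{R}\}$ and $\Pi^+=\{xe_1+ye_2 : x,y\in\mathbb{R},\ y>0\}$. A function $\Phi$ is monogenic in $\Pi^+$ if for every $\zeta\in\Pi^+$ the limit $\lim_{h\to 0,\,h\in\mu}(\Phi(\zeta+h)-\Phi(\zeta))h^{-1}$ exists in $\mathbb{B}$. Write $\Phi=U_1e_1+U_2\,ie_1+U_3e_2+U_4\,ie_2$ with real-valued $U_k$. For $u_1,u_3:\mathbb{R}\to\mathbb{R}$, the (1-3)-problem for $\Pi^+$ is to find a continuous function $\Phi:\overline{\Pi^+}\to\mathbb{B}$ that is monogenic in $\Pi^+$, has a limit in $\mathbb{B}$ as $\|\zeta\|\to\infty$, $\zeta\in\Pi^+$, and satisfies $U_1(\xi,0)=u_1(\xi)$,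 $U_3(\xi,0)=u_3(\xi)$ for all $\xi\in\mathbb{R}$. Theorem. Let $u_1,u_3:\mathbb{R}\to\mathbb{R}$ be continuous functions such that each $u\in\{u_1,u_3\}$ has a finite limit $u(\infty)=\lim_{t\to\infty}u(t)$ (the same limit as $t\to+\infty$ and as $t\to-\infty$) and satisfies the Dini conditions $$\int_0^1\frac{\omega_{\mathbb{R}}(u,\eta)}{\eta}\,d\eta<\infty,\qquad \int_0^1\frac{\omega_{\mathbb{R},\infty}(u,\eta)}{\eta}\,d\eta<\infty,$$ where $\omega_{\mathbb{R}}(u,\varepsilon)=\sup_{|\tau_1-\tau_2|\le\varepsilon}|u(\tau_1)-u(\tau_2)|$ and $\omega_{\mathbb{R},\infty}(u,\varepsilon)=\sup_{|\tau|\ge 1/\varepsilon}|u(\tau)-u(\infty)|$. Then for $u\in\{u_1,u_3\}$ the integral $$S_{\Pi^+}[u](\zeta)=\frac{1}{\pi i}\int_{-\infty}^{+\infty}\frac{u(t)(1+t\zeta)}{t^2+1}(t-\zeta)^{-1}\,dt$$ converges absolutely for every $\zeta\in\Pi^+$, the (1-3)-problem for $\Pi^+$ is solvable, and its general solution is given by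 $$\Phi(\zeta)=S_{\Pi^+}[u_1](\zeta)\,e_1+S_{\Pi^+}[u_3](\zeta)\,e_2+a_1\,ie_1+a_2\,ie_2,\qquad \zeta\in\Pi^+,$$ where $a_1,a_2$ are arbitrary real constants: for all real $a_1,a_2$ the function on the right-hand side extends to a solution on $\overline{\Pi^+}$, and every solution has this form in $\Pi^+$ for some real $a_1,a_2$. In particular, the solutions of the homogeneous problem ($u_1=u_3\equiv 0$) are exactly the constant functions $a_1\,ie_1+a_2\,ie_2$ on $\overline{\Pi^+}$ with $a_1,a_2\in\mathbb{R}$. -/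

import Mathlib

open Filter Topology MeasureTheory
open scoped ENNReal

noncomputable section

namespace BiharmonicPlane

/-- The biharmonic algebra: the commutative two-dimensional complex algebra with basis `e₁ = 1`, `e₂`
and multiplication rule `e₂ ^ 2 = e₁ + 2 i e₂`.  The element with `re = z₁`, `im = z₂`
is `z₁ e₁ + z₂ e₂`, where `z₁` and `z₂` are complex numbers. -/
abbrev BAlg : Type := QuadraticAlgebra ℂ 1 (2 * Complex.I)

/-- The first element of the biharmonic basis. -/
def e₁ : BAlg := 1

/-- The second element of the biharmonic basis. -/
def e₂ : BAlg := ⟨0, 1⟩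

/-- The defining relations of a biharmonic basis. -/
theorem biharmonic_basis : (e₁ ^ 2 + e₂ ^ 2) ^ 2 = 0 ∧ e₁ ^ 2 + e₂ ^ 2 ≠ 0 := by
  have hI := Complex.I_sq
  have h : e₁ ^ 2 + e₂ ^ 2 = (⟨2, 2 * Complex.I⟩ : BAlg) := by
    ext1 <;> simp [e₁, e₂, sq, QuadraticAlgebra.re_one, QuadraticAlgebra.im_one]
    norm_num
  rw [h]
  constructor
  · ext1
    · simp [sq]
      linear_combination 4 * hI
    · simp [sq]
      linear_combination 8 * Complex.I * hI
  · intro h0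
    simpa using congrArg QuadraticAlgebra.re h0

/-- The coordinates of an element of the algebra, as a vector in `ℂ²`. -/
def coords : BAlg →ₗ[ℂ] EuclideanSpace ℂ (Fin 2) where
  toFun a := !₂[a.re, a.im]
  map_add' a b := by ext i; fin_cases i <;> simp
  map_smul' c a := by ext i; fin_cases i <;> simp

/-- The coordinates of an element of the algebra, as a real-linear map. -/
def coordsReal : BAlg →ₗ[ℝ] EuclideanSpace ℂ (Fin 2) where
  toFun := coords
  map_add' := coords.map_add
  map_smul' c a := by ext i; fin_cases i <;> simp [coords]

theorem coords_injective : Function.Injective coords := by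
  intro a b h
  have h0 := congrArg (fun v : EuclideanSpace ℂ (Fin 2) => v 0) h
  have h1 := congrArg (fun v : EuclideanSpace ℂ (Fin 2) => v 1) h
  ext1
  · simpa [coords] using h0
  · simpa [coords] using h1

/-- The Euclidean norm on the algebra. -/
instance : NormedAddCommGroup BAlg :=
  NormedAddCommGroup.induced BAlg (EuclideanSpace ℂ (Fin 2)) coords coords_injective

instance : NormedSpace ℂ BAlg := NormedSpace.induced ℂ BAlg (EuclideanSpace ℂ (Fin 2)) coords

instance : NormedSpace ℝ BAlg := NormedSpace.induced ℝ BAlg (EuclideanSpace ℂ (Fin 2)) coordsReal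

instance : CompleteSpace BAlg := FiniteDimensional.complete ℂ BAlg

theorem norm_eq (a : BAlg) : ‖a‖ = √(‖a.re‖ ^ 2 + ‖a.im‖ ^ 2) := by
  change ‖coords a‖ = _
  simp [coords, EuclideanSpace.norm_eq]

/-- The point `x e₁ + y e₂` of the biharmonic plane. -/
def point (x y : ℝ) : BAlg := (x : ℂ) • e₁ + (y : ℂ) • e₂

/-- The biharmonic plane `μ`. -/
def plane : Set BAlg := {ζ | ∃ x y : ℝ, ζ = point x y}

/-- The open half-plane `Π⁺` of the biharmonic plane. -/
def halfPlane : Set BAlg := {ζ | ∃ x y : ℝ, 0 < y ∧ ζ = point x y}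

/-- The coefficient `U₁` in the expansion `U₁ e₁ + U₂ i e₁ + U₃ e₂ + U₄ i e₂`. -/
def U₁ (a : BAlg) : ℝ := a.re.re

/-- The coefficient `U₃` in the expansion `U₁ e₁ + U₂ i e₁ + U₃ e₂ + U₄ i e₂`. -/
def U₃ (a : BAlg) : ℝ := a.im.re

/-- `Φ` has the derivative `d` at the point `ζ`: the quotients
`(Φ (ζ + h) - Φ ζ) h⁻¹` tend to `d` as `h → 0`, `h ≠ 0`, along the biharmonic plane (whose
non-zero elements are invertible in the algebra). -/
def HasMonogenicDerivAt (Φ : BAlg → BAlg) (d ζ : BAlg) : Prop :=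
  Tendsto (fun h => (Φ (ζ + h) - Φ ζ) * Ring.inverse h) (𝓝[plane \ {0}] 0) (𝓝 d)

/-- `Φ` is monogenic in the set `D` (used for sets that are open in the biharmonic plane). -/
def MonogenicOn (Φ : BAlg → BAlg) (D : Set BAlg) : Prop :=
  ∀ ζ ∈ D, ∃ d, HasMonogenicDerivAt Φ d ζ

/-- `Φ` solves the (1-3)-problem for the half-plane with the boundary data `u₁`, `u₃`. Only the
values of `Φ` on the closed half-plane matter. -/
structure IsSolution13 (u₁ u₃ : ℝ → ℝ) (Φ : BAlg → BAlg) : Prop where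
  continuousOn : ContinuousOn Φ (closure halfPlane)
  monogenicOn : MonogenicOn Φ halfPlane
  limit_infty : ∃ L : BAlg, Tendsto Φ (comap norm atTop ⊓ 𝓟 halfPlane) (𝓝 L)
  boundary₁ : ∀ ξ : ℝ, U₁ (Φ (point ξ 0)) = u₁ ξ
  boundary₃ : ∀ ξ : ℝ, U₃ (Φ (point ξ 0)) = u₃ ξ

/-- The modulus of continuity of `u` on the real line. -/
def modulus (u : ℝ → ℝ) (ε : ℝ) : ℝ≥0∞ :=
  ⨆ (τ₁ : ℝ) (τ₂ : ℝ) (_ : |τ₁ - τ₂| ≤ ε), ENNReal.ofReal |u τ₁ - u τ₂|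

/-- The local centered modulus of continuity of `u` at infinity, where `l` is the limit of `u`. -/
def modulusInfty (u : ℝ → ℝ) (l : ℝ) (ε : ℝ) : ℝ≥0∞ :=
  ⨆ (τ : ℝ) (_ : 1 / ε ≤ |τ|), ENNReal.ofReal |u τ - l|

/-- The Dini condition for a modulus `ω`. -/
def Dini (ω : ℝ → ℝ≥0∞) : Prop :=
  ∫⁻ η in Set.Ioc (0 : ℝ) 1, ω η / ENNReal.ofReal η < ∞

/-- The integrand `u(t) (1 + t ζ) / (t² + 1) · (t - ζ)⁻¹` of the biharmonic Schwartz integral. -/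
def schwartzIntegrand (u : ℝ → ℝ) (ζ : BAlg) (t : ℝ) : BAlg :=
  ((u t / (t ^ 2 + 1) : ℝ) : ℂ) •
    ((e₁ + (t : ℂ) • ζ) * Ring.inverse ((t : ℂ) • e₁ - ζ))

/-- The biharmonic Schwartz integral for the half-plane. -/
def schwartz (u : ℝ → ℝ) (ζ : BAlg) : BAlg :=
  (1 / (Real.pi * Complex.I) : ℂ) • ∫ t : ℝ, schwartzIntegrand u ζ t

end BiharmonicPlane

end

/-! The element ρ = e₂ - i has square zero, so the algebra is the ring of dual numbers ℂ[ρ], and x +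
y e₂ is z + yρ with z = x + iy. The monogenic functions in the half-plane are exactly A(z) + ρ (y
A'(z) + F(z)) with A and F holomorphic (`differentiableOn_of_monogenicOn`,
`exists_hasMonogenicDerivAt`). If A is continuous up to the real line and has a limit at infinity,
Cauchy's estimate on the disc of radius y/2 forces y A' → 0 at both places. The boundary conditions
thus become Re F = u₃ and Re A + Im F = u₁, two Schwarz problems solved one after the other.

Uniqueness: by Phragmén–Lindelöf for exp(±f), a bounded holomorphic f with constant real part on the
real line is constant (`eq_const_of_re_boundary`). With zero data this applies to F, then to A.

Existence: the biharmonic integral equals S(z) + ρ y S'(z), with S the classical Schwartz integral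
(`schwartz_toPlane`). As e₂ = i + ρ, the asserted formula has A = S₁ + i S₃ and F = S₃ up to
constants. It remains to extend S continuously to the real line, with a limit at infinity and
boundary real part u (`exists_continuous_extension`). Since S = 1 for density 1, this reduces to the
Cauchy integral of v = u - l. Around x = Re z it is cut into a far part, a near part with v(x)
subtracted, and v(x) times i times a truncated Poisson integral (`DiniMajorant.integral_cauchy_eq`).
The Dini conditions supply one integrable majorant for the near quotients, so dominated convergence
applies. At a real point x₀ the radius is 1: the Poisson mass tends to π, the other limits are real,
and division by πi yields real part v(x₀). At infinity the radius |x| - |z|/2 makes all three terms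
vanish. -/

noncomputable section

namespace BiharmonicPlane

/-! ### The algebra as dual numbers over ℂ -/

/-- The element `a + b ρ`, where `ρ = e₂ - i` is nilpotent. -/
def pair (a b : ℂ) : BAlg := ⟨a - Complex.I * b, b⟩

/-- The multiplicative functional `z₁ e₁ + z₂ e₂ ↦ z₁ + i z₂`. -/
def scalarPart (a : BAlg) : ℂ := a.re + Complex.I * a.im

/-- The linear identification of the algebra with `ℂ × ℂ` in the basis `1, ρ`. -/
def pairEquiv : (ℂ × ℂ) ≃L[ℂ] BAlg :=
  LinearEquiv.toContinuousLinearEquiv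
    { toFun := fun p => pair p.1 p.2
      invFun := fun a => (scalarPart a, a.im)
      map_add' := fun p q => by
        ext1 <;> simp [pair]
        ring
      map_smul' := fun c p => by
        ext1 <;> simp [pair]
        ring
      left_inv := fun p => by simp [pair, scalarPart]
      right_inv := fun a => by ext1 <;> simp [pair, scalarPart] }

theorem pair_scalarPart (a : BAlg) : pair (scalarPart a) a.im = a := by
  ext1 <;> simp [pair, scalarPart]

@[simp] theorem scalarPart_pair (a b : ℂ) : scalarPart (pair a b) = a := by
  simp [pair, scalarPart]

@[simp] theorem im_pair (a b : ℂ) : (pair a b).im = b := rfl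

theorem pair_mul (a b c d : ℂ) : pair a b * pair c d = pair (a * c) (a * d + b * c) := by
  have hI := Complex.I_sq
  ext1
  · simp [pair]
    linear_combination (b * d) * hI
  · simp [pair]
    ring

theorem pair_add (a b c d : ℂ) : pair a b + pair c d = pair (a + c) (b + d) := by
  ext1 <;> simp [pair]
  ring

theorem pair_sub (a b c d : ℂ) : pair a b - pair c d = pair (a - c) (b - d) := by
  ext1 <;> simp [pair]
  ring

theorem smul_pair (c a b : ℂ) : c • pair a b = pair (c * a) (c * b) := by
  ext1 <;> simp [pair]
  ring

theorem one_eq_pair : (1 : BAlg) = pair 1 0 := by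
  ext1 <;> simp [pair, QuadraticAlgebra.re_one, QuadraticAlgebra.im_one]

theorem e₁_eq_pair : e₁ = pair 1 0 := one_eq_pair

theorem e₂_eq_pair : e₂ = pair Complex.I 1 := by
  ext1 <;> simp [pair, e₂]

/-- Since ρ² = 0, the geometric series for (a + bρ)⁻¹ stops after its linear term. -/
theorem inverse_pair {a : ℂ} (ha : a ≠ 0) (b : ℂ) :
    Ring.inverse (pair a b) = pair a⁻¹ (-b / a ^ 2) := by
  have h : pair a b * pair a⁻¹ (-b / a ^ 2) = 1 := by
    rw [pair_mul, one_eq_pair]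
    congr 1
    · field_simp
    · field_simp
      ring
  have h' : pair a⁻¹ (-b / a ^ 2) * pair a b = 1 := by rw [mul_comm, h]
  exact Ring.inverse_unit (⟨pair a b, _, h, h'⟩ : BAlgˣ)

theorem U₁_pair (a b : ℂ) : U₁ (pair a b) = a.re + b.im := by
  simp [U₁, pair]

theorem U₃_pair (a b : ℂ) : U₃ (pair a b) = b.re := rfl

theorem imaginary_constants (a₁ a₂ : ℝ) :
    ((a₁ * Complex.I) • e₁ + (a₂ * Complex.I) • e₂ : BAlg)
      = pair (a₁ * Complex.I - a₂) (a₂ * Complex.I) := by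
  have hI := Complex.I_mul_I
  rw [e₁_eq_pair, e₂_eq_pair, smul_pair, smul_pair, pair_add]
  congr 1
  · linear_combination (a₂ : ℂ) * hI
  · ring

theorem continuous_scalarPart : Continuous scalarPart :=
  continuous_fst.comp pairEquiv.symm.continuous

theorem continuous_im : Continuous (fun a : BAlg => a.im) :=
  continuous_snd.comp pairEquiv.symm.continuous

theorem tendsto_pair {α : Type*} {l : Filter α} {f g : α → ℂ} {a b : ℂ}
    (hf : Tendsto f l (𝓝 a)) (hg : Tendsto g l (𝓝 b)) :
    Tendsto (fun x => pair (f x) (g x)) l (𝓝 (pair a b)) :=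
  (pairEquiv.continuous.tendsto (a, b)).comp (hf.prodMk_nhds hg)

theorem exists_norm_mul_right_le (a : BAlg) : ∃ C, 0 < C ∧ ∀ b : BAlg, ‖b * a‖ ≤ C * ‖b‖ := by
  have h := (LinearMap.toContinuousLinearMap (LinearMap.mulRight ℂ a)).le_opNorm
  refine ⟨‖LinearMap.toContinuousLinearMap (LinearMap.mulRight ℂ a)‖ + 1, by positivity, ?_⟩
  intro b
  refine (h b).trans ?_
  gcongr
  linarith

/-! ### The biharmonic plane as an isometric copy of ℂ -/

/-- The point `x e₁ + y e₂` attached to the complex number `x + i y`. -/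
def toPlane (z : ℂ) : BAlg := point z.re z.im

@[simp] theorem re_toPlane (z : ℂ) : (toPlane z).re = z.re := by
  simp [toPlane, point, e₁, e₂, QuadraticAlgebra.re_one]

@[simp] theorem im_toPlane (z : ℂ) : (toPlane z).im = z.im := by
  simp [toPlane, point, e₁, e₂, QuadraticAlgebra.im_one]

theorem toPlane_eq_pair (z : ℂ) : toPlane z = pair z z.im := by
  ext1
  · simp [pair]
    apply Complex.ext <;> simp
  · simp [pair]

/-- The complex number `x + i y` attached to the point `x e₁ + y e₂`. -/
def ofPlane (a : BAlg) : ℂ := ⟨a.re.re, a.im.re⟩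

@[simp] theorem ofPlane_toPlane (z : ℂ) : ofPlane (toPlane z) = z := by
  apply Complex.ext <;> simp [ofPlane]

theorem norm_toPlane (z : ℂ) : ‖toPlane z‖ = ‖z‖ := by
  rw [norm_eq, re_toPlane, im_toPlane, Complex.norm_real, Complex.norm_real, Real.norm_eq_abs,
    Real.norm_eq_abs, sq_abs, sq_abs, Complex.norm_def, Complex.normSq_apply, sq, sq]

theorem toPlane_add (z w : ℂ) : toPlane (z + w) = toPlane z + toPlane w := by
  simp [toPlane_eq_pair, pair_add]

theorem toPlane_sub (z w : ℂ) : toPlane (z - w) = toPlane z - toPlane w := by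
  simp [toPlane_eq_pair, pair_sub]

theorem isometry_toPlane : Isometry toPlane :=
  Isometry.of_dist_eq fun z w => by
    rw [dist_eq_norm, dist_eq_norm, ← toPlane_sub, norm_toPlane]

/-- The open upper half-plane as a subset of `ℂ`. -/
def upper : Set ℂ := {z | 0 < z.im}

theorem isOpen_upper : IsOpen upper := isOpen_lt continuous_const Complex.continuous_im

theorem closure_upper : closure upper = {z | 0 ≤ z.im} := Complex.closure_setOfPred_lt_im 0

theorem isPreconnected_upper : IsPreconnected upper :=
  (convex_halfSpace_im_gt 0).isPreconnected

theorem halfPlane_eq : halfPlane = toPlane '' upper := by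
  ext ζ
  constructor
  · rintro ⟨x, y, hy, rfl⟩
    exact ⟨⟨x, y⟩, hy, rfl⟩
  · rintro ⟨z, hz, rfl⟩
    exact ⟨z.re, z.im, hz, rfl⟩

theorem plane_eq : plane = Set.range toPlane := by
  ext ζ
  constructor
  · rintro ⟨x, y, rfl⟩
    exact ⟨⟨x, y⟩, rfl⟩
  · rintro ⟨z, rfl⟩
    exact ⟨z.re, z.im, rfl⟩

theorem closure_halfPlane : closure halfPlane = toPlane '' closure upper := by
  rw [halfPlane_eq, isometry_toPlane.isClosedEmbedding.closure_image_eq]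

theorem toPlane_zero : toPlane 0 = 0 := by
  have := toPlane_sub 0 0
  simpa using this

theorem punctured_plane_eq : plane \ {0} = toPlane '' {0}ᶜ := by
  rw [Set.compl_eq_univ_sdiff, Set.image_sdiff isometry_toPlane.injective, Set.image_univ,
    Set.image_singleton, toPlane_zero, plane_eq]

theorem nhdsWithin_punctured_plane :
    𝓝[plane \ {0}] (0 : BAlg) = map toPlane (𝓝[≠] (0 : ℂ)) := by
  rw [punctured_plane_eq, ← toPlane_zero]
  exact (isometry_toPlane.isEmbedding.map_nhdsWithin_eq _ _).symm

theorem infty_filter_eq :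
    comap norm atTop ⊓ 𝓟 halfPlane = map toPlane (cocompact ℂ ⊓ 𝓟 upper) := by
  have h : cocompact ℂ = comap toPlane (comap norm atTop) := by
    rw [← Metric.cobounded_eq_cocompact, ← comap_norm_atTop (E := ℂ), comap_comap]
    congr 1
    ext z
    simp [norm_toPlane]
  rw [h, halfPlane_eq, Filter.push_pull', map_principal]

/-! ### Monogenic functions in terms of holomorphic functions -/

theorem isLittleO_pair_iff {l : Filter ℂ} {f : ℂ → BAlg} :
    (f =o[l] fun w => w) ↔
      ((fun w => scalarPart (f w)) =o[l] fun w => w) ∧ ((fun w => (f w).im) =o[l] fun w => w) := by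
  have h1 : (fun w => pairEquiv.symm (f w)) =O[l] f :=
    ContinuousLinearMap.isBigO_comp (pairEquiv.symm : BAlg →L[ℂ] ℂ × ℂ) f l
  have h2 : f =O[l] (fun w => pairEquiv.symm (f w)) := by
    have := ContinuousLinearMap.isBigO_comp (pairEquiv : ℂ × ℂ →L[ℂ] BAlg)
      (fun w => pairEquiv.symm (f w)) l
    simpa using this
  have h3 : (f =o[l] fun w => w) ↔ ((fun w => pairEquiv.symm (f w)) =o[l] fun w => w) :=
    ⟨fun h => h1.trans_isLittleO h, fun h => h2.trans_isLittleO h⟩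
  rw [h3]
  exact Asymptotics.isLittleO_prod_left (f' := fun w => scalarPart (f w)) (g' := fun w => (f w).im)

/-- Multiplication in the algebra is bounded. -/
theorem exists_norm_mul_le : ∃ C, 0 < C ∧ ∀ a b : BAlg, ‖a * b‖ ≤ C * ‖a‖ * ‖b‖ := by
  obtain ⟨C, hC, h⟩ := exists_norm_mul_right_le e₂
  refine ⟨1 + C, by positivity, fun a b => ?_⟩
  have hb : a * b = b.re • a + b.im • (a * e₂) := by
    ext1 <;> simp [e₂] <;> ring
  have h1 : ‖b.re‖ ≤ ‖b‖ := by
    rw [norm_eq]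
    exact Real.le_sqrt_of_sq_le (by nlinarith [sq_nonneg ‖b.im‖])
  have h2 : ‖b.im‖ ≤ ‖b‖ := by
    rw [norm_eq]
    exact Real.le_sqrt_of_sq_le (by nlinarith [sq_nonneg ‖b.re‖])
  calc ‖a * b‖ ≤ ‖b.re • a‖ + ‖b.im • (a * e₂)‖ := by rw [hb]; exact norm_add_le _ _
    _ = ‖b.re‖ * ‖a‖ + ‖b.im‖ * ‖a * e₂‖ := by rw [norm_smul, norm_smul]
    _ ≤ ‖b‖ * ‖a‖ + ‖b‖ * (C * ‖a‖) := by gcongr; exact h a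
    _ = (1 + C) * ‖a‖ * ‖b‖ := by ring

theorem inverse_toPlane {w : ℂ} (hw : w ≠ 0) : toPlane w * Ring.inverse (toPlane w) = 1 := by
  rw [toPlane_eq_pair, inverse_pair hw, pair_mul, one_eq_pair]
  congr 1
  · field_simp
  · field_simp
    ring

/-- The coefficients of the inverse are 1/w and -Im w / w², both of modulus at most 1/|w|. -/
theorem exists_norm_inverse_toPlane_le :
    ∃ C, 0 < C ∧ ∀ w : ℂ, w ≠ 0 → ‖Ring.inverse (toPlane w)‖ ≤ C * ‖w‖⁻¹ := by
  refine ⟨‖pair 1 0‖ + ‖pair 0 1‖ + 1, by positivity, fun w hw => ?_⟩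
  have h : Ring.inverse (toPlane w) = w⁻¹ • pair 1 0 + (-(w.im : ℂ) / w ^ 2) • pair 0 1 := by
    rw [toPlane_eq_pair, inverse_pair hw, smul_pair, smul_pair, pair_add]
    simp
  have h2 : ‖-(w.im : ℂ) / w ^ 2‖ ≤ ‖w‖⁻¹ := by
    rw [norm_div, norm_neg, Complex.norm_real, norm_pow, Real.norm_eq_abs]
    have := Complex.abs_im_le_norm w
    have hw' : 0 < ‖w‖ := norm_pos_iff.2 hw
    rw [div_le_iff₀ (by positivity)]
    field_simp
    exact this
  calc ‖Ring.inverse (toPlane w)‖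
      ≤ ‖w⁻¹ • pair 1 0‖ + ‖(-(w.im : ℂ) / w ^ 2) • pair 0 1‖ := by rw [h]; exact norm_add_le _ _
    _ = ‖w‖⁻¹ * ‖pair 1 0‖ + ‖-(w.im : ℂ) / w ^ 2‖ * ‖pair 0 1‖ := by
        rw [norm_smul, norm_smul, norm_inv]
    _ ≤ ‖w‖⁻¹ * ‖pair 1 0‖ + ‖w‖⁻¹ * ‖pair 0 1‖ := by gcongr
    _ ≤ (‖pair 1 0‖ + ‖pair 0 1‖ + 1) * ‖w‖⁻¹ := by
        have : 0 ≤ ‖w‖⁻¹ := by positivity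
        nlinarith

/-- Multiplying by h costs a factor of order |h| and by h⁻¹ a factor of order 1/|h|, so the quotient
can be traded for a first-order expansion. -/
theorem hasMonogenicDerivAt_iff_isLittleO {Φ : BAlg → BAlg} {d : BAlg} {z : ℂ} :
    HasMonogenicDerivAt Φ d (toPlane z) ↔
      (fun w => Φ (toPlane (z + w)) - Φ (toPlane z) - d * toPlane w) =o[𝓝 0] fun w => w := by
  obtain ⟨C, hC, hmul⟩ := exists_norm_mul_le
  obtain ⟨K, hK, hinv⟩ := exists_norm_inverse_toPlane_le
  unfold HasMonogenicDerivAt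
  rw [nhdsWithin_punctured_plane, tendsto_map'_iff]
  simp only [Function.comp_def, ← toPlane_add]
  set f : ℂ → BAlg := fun w => Φ (toPlane (z + w)) - Φ (toPlane z) with hf
  have key : ∀ w : ℂ, w ≠ 0 → f w * Ring.inverse (toPlane w) - d
      = (f w - d * toPlane w) * Ring.inverse (toPlane w) := fun w hw => by
    rw [sub_mul (f w), mul_assoc d, inverse_toPlane hw, mul_one]
  have key' : ∀ w : ℂ, w ≠ 0 → f w - d * toPlane w
      = (f w * Ring.inverse (toPlane w) - d) * toPlane w := fun w hw => by
    rw [sub_mul, mul_assoc, mul_comm (Ring.inverse _), inverse_toPlane hw, mul_one]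
  constructor
  · intro h
    have h0 : Tendsto (fun w => f w * Ring.inverse (toPlane w) - d) (𝓝[≠] 0) (𝓝 0) := by
      simpa using h.sub_const d
    rw [Asymptotics.isLittleO_iff]
    intro ε hε
    have h1 := (Metric.tendsto_nhds.1 h0) (ε / C) (by positivity)
    rw [eventually_nhdsWithin_iff] at h1
    filter_upwards [h1] with w hw
    by_cases hw0 : w = 0
    · subst hw0
      simp [toPlane_zero]
    have h2 := hw hw0
    rw [dist_zero_right] at h2
    change ‖f w - d * toPlane w‖ ≤ _
    rw [key' w hw0]
    calc _ ≤ C * ‖f w * Ring.inverse (toPlane w) - d‖ * ‖toPlane w‖ := hmul _ _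
      _ ≤ C * (ε / C) * ‖w‖ := by rw [norm_toPlane]; gcongr
      _ = ε * ‖w‖ := by field_simp
  · intro h
    rw [Asymptotics.isLittleO_iff] at h
    have h0 : Tendsto (fun w => f w * Ring.inverse (toPlane w) - d) (𝓝[≠] 0) (𝓝 0) := by
      rw [Metric.tendsto_nhds]
      intro ε hε
      have h1 := h (c := ε / (2 * C * K)) (by positivity)
      rw [eventually_nhdsWithin_iff]
      filter_upwards [h1] with w hw hw0
      change ‖f w - d * toPlane w‖ ≤ _ at hw
      have hw' : 0 < ‖w‖ := norm_pos_iff.2 hw0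
      rw [dist_zero_right, key w hw0]
      calc _ ≤ C * ‖f w - d * toPlane w‖ * ‖Ring.inverse (toPlane w)‖ := hmul _ _
        _ ≤ C * (ε / (2 * C * K) * ‖w‖) * (K * ‖w‖⁻¹) := by
            gcongr
            exact hinv w hw0
        _ = ε / 2 := by field_simp
        _ < ε := by linarith
    simpa using h0.add_const d

/-- In (d₀ + d₁ρ)(w + Im w ρ) the scalar part is d₀w, which is ordinary complex differentiability;
the ρ-coefficient carries the non-holomorphic term d₀ Im w. -/
theorem hasMonogenicDerivAt_pair_iff {Φ : BAlg → BAlg} {d₀ d₁ z : ℂ} :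
    HasMonogenicDerivAt Φ (pair d₀ d₁) (toPlane z) ↔
      HasDerivAt (fun w => scalarPart (Φ (toPlane w))) d₀ z ∧
      (fun w => (Φ (toPlane (z + w))).im - (Φ (toPlane z)).im - (d₀ * w.im + d₁ * w))
        =o[𝓝 0] fun w : ℂ => w := by
  rw [hasMonogenicDerivAt_iff_isLittleO, isLittleO_pair_iff, hasDerivAt_iff_isLittleO_nhds_zero]
  have h1 : ∀ w, scalarPart (Φ (toPlane (z + w)) - Φ (toPlane z) - pair d₀ d₁ * toPlane w)
      = scalarPart (Φ (toPlane (z + w))) - scalarPart (Φ (toPlane z)) - w • d₀ := fun w => by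
    rw [toPlane_eq_pair w, pair_mul]
    simp [scalarPart, pair]
    ring
  have h2 : ∀ w, (Φ (toPlane (z + w)) - Φ (toPlane z) - pair d₀ d₁ * toPlane w).im
      = (Φ (toPlane (z + w))).im - (Φ (toPlane z)).im - (d₀ * w.im + d₁ * w) := fun w => by
    rw [toPlane_eq_pair w, pair_mul]
    simp [pair]
  simp only [h1, h2]

/-- The increment of y g contains g(z) Im w. With g = A' this is exactly the non-holomorphic term in
the ρ-coefficient of a monogenic function, which explains the summand y A'. -/
theorem isLittleO_im_mul {g : ℂ → ℂ} {g' z : ℂ} (h : HasDerivAt g g' z) :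
    (fun w => ((z + w).im : ℂ) * g (z + w) - z.im * g z - (g z * w.im + z.im * g' * w))
      =o[𝓝 0] fun w : ℂ => w := by
  have h1 := (hasDerivAt_iff_isLittleO_nhds_zero.1 h).const_mul_left (z.im : ℂ)
  have h2 : (fun w : ℂ => (w.im : ℂ) * (g (z + w) - g z)) =o[𝓝 0] fun w : ℂ => w := by
    have hb : (fun w : ℂ => (w.im : ℂ)) =O[𝓝 0] fun w : ℂ => w :=
      Asymptotics.isBigO_of_le _ fun w => by simpa using Complex.abs_im_le_norm w
    have hc : (fun w : ℂ => g (z + w) - g z) =o[𝓝 0] fun _ : ℂ => (1 : ℂ) := by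
      rw [Asymptotics.isLittleO_one_iff]
      have hcont : Tendsto (fun w => g (z + w)) (𝓝 0) (𝓝 (g (z + 0))) :=
        Tendsto.comp (by simpa using h.continuousAt.tendsto) ((continuous_const_add z).tendsto 0)
      simpa using hcont.sub_const (g z)
    simpa using hb.mul_isLittleO hc
  refine (h1.add h2).congr_left fun w => ?_
  simp
  ring

theorem exists_hasMonogenicDerivAt {Φ : BAlg → BAlg} {A F : ℂ → ℂ}
    (hA : DifferentiableOn ℂ A upper) (hF : DifferentiableOn ℂ F upper)
    (hΦ : ∀ z ∈ upper, Φ (toPlane z) = pair (A z) (z.im * deriv A z + F z)) {z : ℂ}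
    (hz : z ∈ upper) : ∃ d, HasMonogenicDerivAt Φ d (toPlane z) := by
  have hn : upper ∈ 𝓝 z := isOpen_upper.mem_nhds hz
  have hA' : HasDerivAt (deriv A) (deriv (deriv A) z) z :=
    ((hA.deriv isOpen_upper).differentiableAt hn).hasDerivAt
  have hF' := (hF.differentiableAt hn).hasDerivAt
  refine ⟨pair (deriv A z) (z.im * deriv (deriv A) z + deriv F z),
    hasMonogenicDerivAt_pair_iff.2 ⟨?_, ?_⟩⟩
  · refine (hA.differentiableAt hn).hasDerivAt.congr_of_eventuallyEq ?_
    filter_upwards [hn] with w hw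
    rw [hΦ w hw, scalarPart_pair]
  · have h := (isLittleO_im_mul hA').add (hasDerivAt_iff_isLittleO_nhds_zero.1 hF')
    refine h.congr' ?_ EventuallyEq.rfl
    have : Tendsto (fun w => z + w) (𝓝 0) (𝓝 z) := by
      simpa using (continuous_const_add z).tendsto 0
    filter_upwards [this hn] with w hw
    rw [hΦ _ hw, hΦ z hz, im_pair, im_pair, smul_eq_mul]
    ring

theorem differentiableOn_of_monogenicOn {Φ : BAlg → BAlg} (h : MonogenicOn Φ halfPlane) :
    DifferentiableOn ℂ (fun w => scalarPart (Φ (toPlane w))) upper ∧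
    DifferentiableOn ℂ (fun w => (Φ (toPlane w)).im
      - w.im * deriv (fun w => scalarPart (Φ (toPlane w))) w) upper := by
  have hd : ∀ z ∈ upper, ∃ d₀ d₁, HasMonogenicDerivAt Φ (pair d₀ d₁) (toPlane z) := by
    intro z hz
    obtain ⟨d, hd⟩ := h (toPlane z) (by rw [halfPlane_eq]; exact ⟨z, hz, rfl⟩)
    exact ⟨scalarPart d, d.im, by rwa [pair_scalarPart]⟩
  have hA : DifferentiableOn ℂ (fun w => scalarPart (Φ (toPlane w))) upper := by
    intro z hz
    obtain ⟨d₀, d₁, hd⟩ := hd z hz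
    exact (hasMonogenicDerivAt_pair_iff.1 hd).1.differentiableAt.differentiableWithinAt
  refine ⟨hA, fun z hz => ?_⟩
  have hn : upper ∈ 𝓝 z := isOpen_upper.mem_nhds hz
  obtain ⟨d₀, d₁, hd⟩ := hd z hz
  obtain ⟨h1, h2⟩ := hasMonogenicDerivAt_pair_iff.1 hd
  set A := fun w => scalarPart (Φ (toPlane w)) with hAdef
  have hA' : HasDerivAt (deriv A) (deriv (deriv A) z) z :=
    ((hA.deriv isOpen_upper).differentiableAt hn).hasDerivAt
  -- Here d₀ = A'(z), so the Im w terms cancel and a complex-linear increment remains.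
  have h3 := h2.sub (isLittleO_im_mul hA')
  have h4 : HasDerivAt (fun w => (Φ (toPlane w)).im - w.im * deriv A w)
      (d₁ - z.im * deriv (deriv A) z) z := by
    rw [hasDerivAt_iff_isLittleO_nhds_zero]
    refine h3.congr_left fun w => ?_
    rw [h1.deriv, smul_eq_mul]
    ring
  exact h4.differentiableAt.differentiableWithinAt

/-! ### Boundary behaviour of y A' -/

theorem closedBall_subset_upper {z : ℂ} (hz : z ∈ upper) :
    Metric.closedBall z (z.im / 2) ⊆ upper := by
  intro w hw
  rw [Metric.mem_closedBall, dist_eq_norm] at hw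
  have h1 := (Complex.abs_im_le_norm (w - z)).trans hw
  rw [Complex.sub_im, abs_le] at h1
  have hz' : 0 < z.im := hz
  change 0 < w.im
  linarith [h1.1]

/-- Cauchy's estimate on the disc of radius y/2; the factor y cancels the radius, so the bound does
not degenerate near the real line. -/
theorem norm_im_mul_deriv_le {A : ℂ → ℂ} (hA : DifferentiableOn ℂ A upper) {z L : ℂ}
    (hz : z ∈ upper) {ε : ℝ} (h : ∀ w ∈ Metric.closedBall z (z.im / 2), ‖A w - L‖ ≤ ε) :
    ‖(z.im : ℂ) * deriv A z‖ ≤ 2 * ε := by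
  have hz' : 0 < z.im := hz
  have h1 : ‖deriv (fun w => A w - L) z‖ ≤ ε / (z.im / 2) := by
    refine Complex.norm_deriv_le_of_forall_mem_sphere_norm_le (by positivity) ?_
      fun w hw => h w (Metric.sphere_subset_closedBall hw)
    refine DifferentiableOn.diffContOnCl ?_
    exact (hA.sub_const L).mono (Metric.closure_ball_subset_closedBall.trans
      (closedBall_subset_upper hz))
  rw [deriv_sub_const] at h1
  rw [norm_mul, Complex.norm_real, Real.norm_of_nonneg hz'.le]
  calc z.im * ‖deriv A z‖ ≤ z.im * (ε / (z.im / 2)) := by gcongr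
    _ = 2 * ε := by field_simp

theorem tendsto_im_mul_deriv {A : ℂ → ℂ} (hA : DifferentiableOn ℂ A upper) {x₀ : ℂ}
    (hx₀ : x₀.im = 0) {L : ℂ} (hL : Tendsto A (𝓝[upper] x₀) (𝓝 L)) :
    Tendsto (fun z => (z.im : ℂ) * deriv A z) (𝓝[upper] x₀) (𝓝 0) := by
  rw [Metric.tendsto_nhdsWithin_nhds] at hL ⊢
  intro ε hε
  obtain ⟨δ, hδ, h⟩ := hL (ε / 4) (by positivity)
  refine ⟨δ / 2, by positivity, fun z hz hzd => ?_⟩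
  rw [dist_zero_right]
  have hzi : z.im ≤ dist z x₀ := by
    have := Complex.abs_im_le_norm (z - x₀)
    rw [Complex.sub_im, hx₀, sub_zero] at this
    rw [dist_eq_norm]
    exact (le_abs_self _).trans this
  have := norm_im_mul_deriv_le hA hz (L := L) (ε := ε / 4) fun w hw => by
    rw [← dist_eq_norm]
    refine (h (closedBall_subset_upper hz hw) ?_).le
    have h1 := Metric.mem_closedBall.1 hw
    have h2 := dist_triangle w z x₀
    linarith
  linarith

theorem tendsto_im_mul_deriv_infty {A : ℂ → ℂ} (hA : DifferentiableOn ℂ A upper) {L : ℂ}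
    (hL : Tendsto A (cocompact ℂ ⊓ 𝓟 upper) (𝓝 L)) :
    Tendsto (fun z => (z.im : ℂ) * deriv A z) (cocompact ℂ ⊓ 𝓟 upper) (𝓝 0) := by
  rw [Metric.tendsto_nhds] at hL ⊢
  intro ε hε
  have h := hL (ε / 4) (by positivity)
  rw [eventually_inf_principal, ← Metric.cobounded_eq_cocompact, ← comap_norm_atTop,
    eventually_comap, eventually_atTop] at h ⊢
  obtain ⟨R, hR⟩ := h
  refine ⟨2 * R, fun r hr z hzr hz => ?_⟩
  rw [dist_zero_right]
  have := norm_im_mul_deriv_le hA hz (L := L) (ε := ε / 4) fun w hw => by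
    rw [← dist_eq_norm]
    refine (hR ‖w‖ ?_ w rfl (closedBall_subset_upper hz hw)).le
    -- As Im z ≤ |z|, every point of the disc has modulus at least |z|/2 ≥ R.
    have h1 := mem_closedBall_iff_norm'.1 hw
    have h2 := norm_sub_norm_le z w
    have h3 := (le_abs_self _).trans (Complex.abs_im_le_norm z)
    linarith
  linarith

/-- On the real line the factor Im z = 0 makes the value of `deriv A` irrelevant, and the limit from
inside is 0 as well. -/
theorem continuousOn_im_mul_deriv {A : ℂ → ℂ} (hA : DifferentiableOn ℂ A upper)
    (hc : ContinuousOn A (closure upper)) :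
    ContinuousOn (fun z => (z.im : ℂ) * deriv A z) (closure upper) := by
  intro z hz
  rw [closure_upper] at hz
  rcases (show 0 ≤ z.im from hz).lt_or_eq with h | h
  · have hn : upper ∈ 𝓝 z := isOpen_upper.mem_nhds h
    refine ContinuousAt.continuousWithinAt ?_
    exact (Complex.continuous_ofReal.comp Complex.continuous_im).continuousAt.mul
      ((hA.deriv isOpen_upper).differentiableAt hn).continuousAt
  · have hz' : z ∈ closure upper := by rw [closure_upper]; exact hz
    have h1 := tendsto_im_mul_deriv hA h.symm ((hc z hz').mono subset_closure)
    rw [ContinuousWithinAt, ← h, Complex.ofReal_zero, zero_mul]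
    rw [Metric.tendsto_nhdsWithin_nhds] at h1 ⊢
    intro ε hε
    obtain ⟨δ, hδ, H⟩ := h1 ε hε
    refine ⟨δ, hδ, fun w hw hwd => ?_⟩
    rw [closure_upper] at hw
    rcases (show 0 ≤ w.im from hw).lt_or_eq with h | h
    · exact H h hwd
    · rw [← h]
      simpa using hε

/-! ### Bounded holomorphic functions and their boundary values -/

theorem bounded_of_limits {A : ℂ → ℂ} (hc : ContinuousOn A (closure upper)) {L : ℂ}
    (hL : Tendsto A (cocompact ℂ ⊓ 𝓟 upper) (𝓝 L)) : ∃ C, ∀ z ∈ upper, ‖A z‖ ≤ C := by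
  have h := (Metric.tendsto_nhds.1 hL) 1 one_pos
  rw [eventually_inf_principal, ← Metric.cobounded_eq_cocompact, ← comap_norm_atTop,
    eventually_comap, eventually_atTop] at h
  obtain ⟨R, hR⟩ := h
  have hK : IsCompact (Metric.closedBall (0 : ℂ) R ∩ closure upper) :=
    (isCompact_closedBall _ _).inter_right isClosed_closure
  obtain ⟨C, hC⟩ := hK.exists_bound_of_continuousOn (hc.mono Set.inter_subset_right)
  refine ⟨max C (‖L‖ + 1), fun z hz => ?_⟩
  rcases le_total ‖z‖ R with h | h
  · exact (hC z ⟨by simpa using h, subset_closure hz⟩).trans (le_max_left _ _)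
  · have h1 := hR ‖z‖ h z rfl hz
    rw [dist_eq_norm] at h1
    have h2 := norm_le_norm_add_norm_sub' (A z) L
    exact (by linarith : ‖A z‖ ≤ ‖L‖ + 1).trans (le_max_right _ _)

/-- Phragmén–Lindelöf in the right half-plane, rotated by w ↦ iw. The bound `K` only supplies the
growth condition; the boundary bound `C` is what survives. -/
theorem norm_le_of_boundary {f : ℂ → ℂ} (hd : DiffContOnCl ℂ f upper) {C K : ℝ}
    (hK : ∀ z ∈ upper, ‖f z‖ ≤ K) (hC : ∀ x : ℝ, ‖f x‖ ≤ C) {z : ℂ} (hz : z ∈ upper) :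
    ‖f z‖ ≤ C := by
  have hI := Complex.I_mul_I
  have hmaps : ∀ w : ℂ, 0 < w.re → Complex.I * w ∈ upper := fun w hw => by
    simpa [upper] using hw
  have hbd : ∀ w : ℂ, 0 < w.re → ‖f (Complex.I * w)‖ ≤ K := fun w hw => hK _ (hmaps w hw)
  have h := PhragmenLindelof.right_half_plane_of_bounded_on_real
    (f := fun w => f (Complex.I * w)) (C := C) (z := -Complex.I * z) ?_ ?_ ?_ ?_ ?_
  · have : Complex.I * (-Complex.I * z) = z := by linear_combination -z * hI
    simpa only [this] using h
  · exact hd.comp (Differentiable.diffContOnCl (by fun_prop)) fun w hw => hmaps w hw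
  -- A bounded function satisfies the growth condition with order 1 < 2 and coefficient 0.
  · refine ⟨1, by norm_num, 0, ?_⟩
    refine Asymptotics.IsBigO.of_bound K ?_
    rw [eventually_inf_principal]
    filter_upwards with w hw
    simpa using hbd w hw
  · refine ⟨K, ?_⟩
    rw [eventually_map]
    filter_upwards [eventually_gt_atTop 0] with x hx
    exact hbd x (by simpa using hx)
  · intro x
    have : Complex.I * (x * Complex.I) = ((-x : ℝ) : ℂ) := by
      push_cast
      linear_combination (x : ℂ) * hI
    rw [this]
    exact hC _
  · have : 0 < z.im := hz
    simpa using this.le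

/-- Apply the modulus bound to exp f, since |exp f| = exp(Re f). -/
theorem re_le_of_boundary {f : ℂ → ℂ} (hd : DiffContOnCl ℂ f upper) {c K : ℝ}
    (hK : ∀ z ∈ upper, ‖f z‖ ≤ K) (hc : ∀ x : ℝ, (f x).re ≤ c) {z : ℂ} (hz : z ∈ upper) :
    (f z).re ≤ c := by
  have h : ‖Complex.exp (f z)‖ ≤ Real.exp c :=
    norm_le_of_boundary (f := fun z => Complex.exp (f z)) (K := Real.exp K)
      (Complex.differentiable_exp.comp_diffContOnCl hd)
      (fun w hw => by
        rw [Complex.norm_exp]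
        exact Real.exp_le_exp.2 ((Complex.re_le_norm _).trans (hK w hw)))
      (fun x => by
        rw [Complex.norm_exp]
        exact Real.exp_le_exp.2 (hc x)) hz
  rw [Complex.norm_exp] at h
  exact Real.exp_le_exp.1 h

/-- A bounded holomorphic function on the upper half-plane whose real part is constant on the
boundary is constant. -/
theorem eq_const_of_re_boundary {f : ℂ → ℂ} (hd : DifferentiableOn ℂ f upper)
    (hcont : ContinuousOn f (closure upper)) {c K : ℝ}
    (hK : ∀ z ∈ upper, ‖f z‖ ≤ K) (hc : ∀ x : ℝ, (f x).re = c) :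
    ∃ b : ℝ, ∀ z ∈ closure upper, f z = c + b * Complex.I := by
  have hdc : DiffContOnCl ℂ f upper := ⟨hd, hcont⟩
  have hre : ∀ z ∈ upper, (f z).re = c := fun z hz => by
    refine le_antisymm (re_le_of_boundary hdc hK (fun x => (hc x).le) hz) ?_
    have := re_le_of_boundary (f := fun z => -f z) (c := -c) hdc.neg
      (by simpa using hK) (fun x => by simp [hc x]) hz
    simpa using this
  have hI : Complex.I ∈ upper := by simp [upper]
  obtain ⟨b, hb⟩ := AnalyticOnNhd.eq_const_of_re_eq_const (hd.analyticOnNhd isOpen_upper) hre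
    isOpen_upper ⟨⟨_, hI⟩, isPreconnected_upper⟩
  have hcl : Set.EqOn f (fun _ => b) (closure upper) :=
    Set.EqOn.of_subset_closure hb hcont continuousOn_const subset_closure subset_rfl
  refine ⟨b.im, fun z hz => ?_⟩
  rw [hcl hz, ← hre _ hI, hb _ hI, Complex.re_add_im]

/-! ### Solutions from holomorphic pairs, and the homogeneous problem -/

theorem ofReal_mem_closure_upper (x : ℝ) : (x : ℂ) ∈ closure upper := by
  rw [closure_upper]
  simp

theorem point_zero_eq (x : ℝ) : point x 0 = toPlane x := rfl

/-- Holomorphic functions `A`, `F` that are continuous up to the boundary and have limits at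
infinity give a solution `A + ρ (y A' + F)`. -/
theorem isSolution_of_pair {A F : ℂ → ℂ} (hA : DifferentiableOn ℂ A upper)
    (hF : DifferentiableOn ℂ F upper) (hAc : ContinuousOn A (closure upper))
    (hFc : ContinuousOn F (closure upper)) {a b : ℂ}
    (hAl : Tendsto A (cocompact ℂ ⊓ 𝓟 upper) (𝓝 a))
    (hFl : Tendsto F (cocompact ℂ ⊓ 𝓟 upper) (𝓝 b)) {u₁ u₃ : ℝ → ℝ}
    (h₁ : ∀ x : ℝ, (A x).re + (F x).im = u₁ x) (h₃ : ∀ x : ℝ, (F x).re = u₃ x)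
    {Φ : BAlg → BAlg}
    (hΦ : ∀ z ∈ closure upper, Φ (toPlane z) = pair (A z) (z.im * deriv A z + F z)) :
    IsSolution13 u₁ u₃ Φ where
  continuousOn := by
    have hB := (continuousOn_im_mul_deriv hA hAc).add hFc
    have h : ContinuousOn (fun z => Φ (toPlane z)) (closure upper) :=
      ContinuousOn.congr (fun z hz => tendsto_pair (hAc z hz) (hB z hz)) hΦ
    rw [closure_halfPlane]
    rintro _ ⟨z, hz, rfl⟩
    rw [ContinuousWithinAt, ← isometry_toPlane.isEmbedding.map_nhdsWithin_eq, tendsto_map'_iff]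
    exact h z hz
  monogenicOn := by
    rw [halfPlane_eq]
    rintro _ ⟨z, hz, rfl⟩
    exact exists_hasMonogenicDerivAt hA hF (fun w hw => hΦ w (subset_closure hw)) hz
  limit_infty := by
    refine ⟨pair a (0 + b), ?_⟩
    rw [infty_filter_eq, tendsto_map'_iff]
    refine (tendsto_pair hAl ((tendsto_im_mul_deriv_infty hA hAl).add hFl)).congr' ?_
    rw [EventuallyEq, eventually_inf_principal]
    filter_upwards with z hz using (hΦ z (subset_closure hz)).symm
  boundary₁ x := by
    rw [point_zero_eq, hΦ _ (ofReal_mem_closure_upper x), U₁_pair]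
    simpa using h₁ x
  boundary₃ x := by
    rw [point_zero_eq, hΦ _ (ofReal_mem_closure_upper x), U₃_pair]
    simpa using h₃ x

theorem isSolution_const {a₁ a₂ : ℝ} {Φ : BAlg → BAlg}
    (h : ∀ ζ ∈ closure halfPlane, Φ ζ = (a₁ * Complex.I) • e₁ + (a₂ * Complex.I) • e₂) :
    IsSolution13 (fun _ => 0) (fun _ => 0) Φ := by
  refine isSolution_of_pair (A := fun _ => a₁ * Complex.I - a₂) (F := fun _ => a₂ * Complex.I)
    (differentiableOn_const _) (differentiableOn_const _) continuousOn_const continuousOn_const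
    tendsto_const_nhds tendsto_const_nhds (by simp) (by simp) fun z hz => ?_
  rw [h _ (by rw [closure_halfPlane]; exact ⟨z, hz, rfl⟩), imaginary_constants]
  simp

theorem eq_const_of_isSolution_zero {Φ : BAlg → BAlg}
    (h : IsSolution13 (fun _ => 0) (fun _ => 0) Φ) : ∃ a₁ a₂ : ℝ,
      ∀ ζ ∈ closure halfPlane, Φ ζ = (a₁ * Complex.I) • e₁ + (a₂ * Complex.I) • e₂ := by
  obtain ⟨hA, hF⟩ := differentiableOn_of_monogenicOn h.monogenicOn
  have hc : ContinuousOn (fun z => Φ (toPlane z)) (closure upper) :=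
    h.continuousOn.comp isometry_toPlane.continuous.continuousOn fun z hz => by
      rw [closure_halfPlane]
      exact ⟨z, hz, rfl⟩
  obtain ⟨L, hL⟩ := h.limit_infty
  rw [infty_filter_eq, tendsto_map'_iff] at hL
  have hAc : ContinuousOn (fun z => scalarPart (Φ (toPlane z))) (closure upper) :=
    continuous_scalarPart.comp_continuousOn hc
  have hAl : Tendsto (fun z => scalarPart (Φ (toPlane z))) (cocompact ℂ ⊓ 𝓟 upper)
      (𝓝 (scalarPart L)) := (continuous_scalarPart.tendsto L).comp hL
  set A := fun z => scalarPart (Φ (toPlane z)) with hAdef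
  set F := fun z => (Φ (toPlane z)).im - z.im * deriv A z with hFdef
  have hFc : ContinuousOn F (closure upper) :=
    (continuous_im.comp_continuousOn hc).sub (continuousOn_im_mul_deriv hA hAc)
  have hFl : Tendsto F (cocompact ℂ ⊓ 𝓟 upper) (𝓝 (L.im - 0)) :=
    ((continuous_im.tendsto L).comp hL).sub (tendsto_im_mul_deriv_infty hA hAl)
  obtain ⟨C, hC⟩ := bounded_of_limits hAc hAl
  obtain ⟨K, hK⟩ := bounded_of_limits hFc hFl
  have hFre : ∀ x : ℝ, (F x).re = 0 := fun x => by
    have := h.boundary₃ x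
    rw [point_zero_eq] at this
    simpa [hFdef, U₃] using this
  obtain ⟨b, hb⟩ := eq_const_of_re_boundary hF hFc hK hFre
  -- F is the constant ib, so the condition U₁ = Re A + Im F = 0 fixes Re A.
  have hAre : ∀ x : ℝ, (A x).re = -b := fun x => by
    have h1 := h.boundary₁ x
    have h2 := hb x (ofReal_mem_closure_upper x)
    rw [point_zero_eq, U₁] at h1
    have h3 : (Φ (toPlane x)).im = b * Complex.I := by simpa [hFdef] using h2
    simp [hAdef, scalarPart, h1, h3]
  obtain ⟨a, ha⟩ := eq_const_of_re_boundary hA hAc hC hAre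
  have hA0 : ∀ z ∈ closure upper, (z.im : ℂ) * deriv A z = 0 := by
    intro z hz
    rcases (show 0 ≤ z.im by rw [closure_upper] at hz; exact hz).lt_or_eq with h | h
    · have hev : A =ᶠ[𝓝 z] fun _ => ((-b : ℝ) : ℂ) + a * Complex.I := by
        filter_upwards [isOpen_upper.mem_nhds h] with w hw using ha w (subset_closure hw)
      rw [hev.deriv_eq, deriv_const, mul_zero]
    · rw [← h]
      simp
  refine ⟨a, b, ?_⟩
  rw [closure_halfPlane]
  rintro _ ⟨z, hz, rfl⟩
  rw [imaginary_constants, ← pair_scalarPart (Φ (toPlane z))]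
  have h1 := ha z hz
  have h2 := hb z hz
  simp only [hFdef, hA0 z hz] at h2
  congr 1
  · change A z = _
    rw [h1]
    push_cast
    ring
  · simpa using h2

theorem IsSolution13.sub {u₁ u₃ v₁ v₃ : ℝ → ℝ} {Φ Ψ : BAlg → BAlg} (hΦ : IsSolution13 u₁ u₃ Φ)
    (hΨ : IsSolution13 v₁ v₃ Ψ) :
    IsSolution13 (fun x => u₁ x - v₁ x) (fun x => u₃ x - v₃ x) (fun ζ => Φ ζ - Ψ ζ) where
  continuousOn := hΦ.continuousOn.sub hΨ.continuousOn
  monogenicOn ζ hζ := by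
    obtain ⟨d, hd⟩ := hΦ.monogenicOn ζ hζ
    obtain ⟨d', hd'⟩ := hΨ.monogenicOn ζ hζ
    refine ⟨d - d', (Tendsto.sub hd hd').congr fun h => ?_⟩
    ring
  limit_infty := by
    obtain ⟨L, hL⟩ := hΦ.limit_infty
    obtain ⟨L', hL'⟩ := hΨ.limit_infty
    exact ⟨L - L', hL.sub hL'⟩
  boundary₁ x := by
    rw [← hΦ.boundary₁ x, ← hΨ.boundary₁ x]
    simp [U₁]
  boundary₃ x := by
    rw [← hΦ.boundary₃ x, ← hΨ.boundary₃ x]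
    simp [U₃]

/-! ### The Poisson and Schwartz kernels, and the Schwartz integral inside the half-plane -/

theorem integrable_poisson {y : ℝ} (hy : 0 < y) : Integrable fun r : ℝ => y / (r ^ 2 + y ^ 2) := by
  have h := (integrable_inv_one_add_sq.comp_div hy.ne').const_mul y⁻¹
  refine h.congr (Eventually.of_forall fun r => ?_)
  have : r ^ 2 + y ^ 2 ≠ 0 := by positivity
  field_simp
  ring

theorem integral_poisson {y : ℝ} (hy : 0 < y) : ∫ r : ℝ, y / (r ^ 2 + y ^ 2) = Real.pi := by
  have h : ∀ r : ℝ, y / (r ^ 2 + y ^ 2) = y⁻¹ * (1 + (r / y) ^ 2)⁻¹ := fun r => by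
    have : r ^ 2 + y ^ 2 ≠ 0 := by positivity
    field_simp
    ring
  simp_rw [h]
  rw [integral_const_mul, Measure.integral_comp_div (fun s => (1 + s ^ 2)⁻¹),
    integral_univ_inv_one_add_sq, abs_of_pos hy, smul_eq_mul]
  field_simp

theorem sub_ne_zero_of_mem_upper {z : ℂ} (hz : z ∈ upper) (t : ℝ) : (t : ℂ) - z ≠ 0 := by
  intro h
  have h1 := congrArg Complex.im h
  have hz' : 0 < z.im := hz
  simp at h1
  linarith

theorem norm_sub_sq (z : ℂ) (t : ℝ) : ‖(t : ℂ) - z‖ ^ 2 = (t - z.re) ^ 2 + z.im ^ 2 := by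
  rw [Complex.sq_norm, Complex.normSq_apply]
  simp
  ring

theorem integrable_norm_sub_inv_sq {z : ℂ} (hz : z ∈ upper) :
    Integrable fun t : ℝ => (‖(t : ℂ) - z‖ ^ 2)⁻¹ := by
  have hz' : 0 < z.im := hz
  have h := ((integrable_poisson hz').const_mul z.im⁻¹).comp_sub_right z.re
  refine h.congr (Eventually.of_forall fun t => ?_)
  change _ = (‖(t : ℂ) - z‖ ^ 2)⁻¹
  rw [norm_sub_sq]
  have : (t - z.re) ^ 2 + z.im ^ 2 ≠ 0 := by positivity
  field_simp

/-- The kernel of the complex Schwartz integral for the upper half-plane, without the factor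
`1 / (π i)`. -/
def schwartzKernel (z : ℂ) (t : ℝ) : ℂ := ((t : ℂ) - z)⁻¹ - ((t / (t ^ 2 + 1) : ℝ) : ℂ)

theorem I_mem_upper : Complex.I ∈ upper := by simp [upper]

theorem ofReal_sq_add_one_ne (t : ℝ) : (t : ℂ) ^ 2 + 1 ≠ 0 := by
  have h : ((t ^ 2 + 1 : ℝ) : ℂ) ≠ 0 := by
    rw [Complex.ofReal_ne_zero]
    positivity
  simpa using h

theorem schwartzKernel_I (t : ℝ) : schwartzKernel Complex.I t = (((1 + t ^ 2)⁻¹ : ℝ) : ℂ) * Complex.I := by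
  have h1 := sub_ne_zero_of_mem_upper I_mem_upper t
  have h2 := ofReal_sq_add_one_ne t
  have h3 : 1 + (t : ℂ) ^ 2 ≠ 0 := by rwa [add_comm]
  have hI := Complex.I_sq
  rw [schwartzKernel]
  push_cast
  field_simp
  linear_combination ((t : ℂ) ^ 2 + 1) * hI

theorem schwartzKernel_sub {z w : ℂ} (hz : z ∈ upper) (hw : w ∈ upper) (t : ℝ) :
    schwartzKernel z t - schwartzKernel w t = (z - w) * (((t : ℂ) - z)⁻¹ * ((t : ℂ) - w)⁻¹) := by
  have h1 := sub_ne_zero_of_mem_upper hz t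
  have h2 := sub_ne_zero_of_mem_upper hw t
  rw [schwartzKernel, schwartzKernel]
  field_simp
  ring

theorem continuous_cauchyKernel {z : ℂ} (hz : z ∈ upper) :
    Continuous fun t : ℝ => ((t : ℂ) - z)⁻¹ :=
  (Complex.continuous_ofReal.sub continuous_const).inv₀ (sub_ne_zero_of_mem_upper hz)

theorem continuous_schwartzKernel {z : ℂ} (hz : z ∈ upper) : Continuous (schwartzKernel z) := by
  refine (continuous_cauchyKernel hz).sub (Complex.continuous_ofReal.comp ?_)
  exact continuous_id.div (by fun_prop) fun t => by positivity

/-- Compare with z = i, where the kernel is i/(1 + t²). The difference of the two kernels is (z -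
i)/((t - z)(t - i)), controlled by the inverse squares of the two distances. -/
theorem integrable_schwartzKernel {z : ℂ} (hz : z ∈ upper) : Integrable (schwartzKernel z) := by
  have hI : Integrable (schwartzKernel Complex.I) := by
    refine (integrable_inv_one_add_sq.ofReal.mul_const Complex.I).congr
      (Eventually.of_forall fun t => ?_)
    exact (schwartzKernel_I t).symm
  have h : Integrable fun t => schwartzKernel z t - schwartzKernel Complex.I t := by
    have hb := ((integrable_norm_sub_inv_sq hz).add
      (integrable_norm_sub_inv_sq I_mem_upper)).const_mul ‖z - Complex.I‖
    refine hb.mono' ((continuous_schwartzKernel hz).sub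
      (continuous_schwartzKernel I_mem_upper)).aestronglyMeasurable
      (Eventually.of_forall fun t => ?_)
    rw [schwartzKernel_sub hz I_mem_upper, norm_mul, norm_mul, norm_inv, norm_inv]
    gcongr
    simp only [Pi.add_apply, ← inv_pow]
    nlinarith [two_mul_le_add_sq ‖(t : ℂ) - z‖⁻¹ ‖(t : ℂ) - Complex.I‖⁻¹,
      sq_nonneg ‖(t : ℂ) - z‖⁻¹, sq_nonneg ‖(t : ℂ) - Complex.I‖⁻¹]
  exact (h.add hI).congr (Eventually.of_forall fun t => by simp)

theorem integrable_mul_of_bounded {u : ℝ → ℝ} (hu : Continuous u) {M : ℝ} (hM : ∀ t, |u t| ≤ M)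
    {f : ℝ → ℂ} (hf : Integrable f) : Integrable fun t => (u t : ℂ) * f t :=
  hf.bdd_mul (c := M) (Complex.continuous_ofReal.comp hu).aestronglyMeasurable
    (Eventually.of_forall fun t => by simpa using hM t)

theorem integrable_cauchyKernel_sq {z : ℂ} (hz : z ∈ upper) :
    Integrable fun t : ℝ => (((t : ℂ) - z)⁻¹) ^ 2 :=
  (integrable_norm_sub_inv_sq hz).mono' ((continuous_cauchyKernel hz).pow 2).aestronglyMeasurable
    (Eventually.of_forall fun t => by rw [norm_pow, norm_inv, inv_pow])

/-- The complex Schwartz integral of `u` for the upper half-plane. -/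
def complexSchwartz (u : ℝ → ℝ) (z : ℂ) : ℂ :=
  (1 / (Real.pi * Complex.I)) * ∫ t : ℝ, (u t : ℂ) * schwartzKernel z t

theorem hasDerivAt_complexSchwartz {u : ℝ → ℝ} (hu : Continuous u) {M : ℝ}
    (hM : ∀ t, |u t| ≤ M) {z : ℂ} (hz : z ∈ upper) :
    HasDerivAt (complexSchwartz u)
      ((1 / (Real.pi * Complex.I)) * ∫ t : ℝ, (u t : ℂ) * (((t : ℂ) - z)⁻¹) ^ 2) z := by
  have hz' : 0 < z.im := hz
  have hball : ∀ w ∈ Metric.ball z (z.im / 2), w ∈ upper := fun w hw =>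
    closedBall_subset_upper hz (Metric.ball_subset_closedBall hw)
  have hM0 : 0 ≤ M := (abs_nonneg _).trans (hM 0)
  refine HasDerivAt.const_mul _ ?_
  refine (hasDerivAt_integral_of_dominated_loc_of_deriv_le
    (F := fun w (t : ℝ) => (u t : ℂ) * schwartzKernel w t)
    (F' := fun w (t : ℝ) => (u t : ℂ) * (((t : ℂ) - w)⁻¹) ^ 2)
    -- For |w - z| < y/2 ≤ |t - z|/2 one has |t - w| ≥ |t - z|/2, whence the factor 4.
    (bound := fun t : ℝ => M * (4 * (‖(t : ℂ) - z‖ ^ 2)⁻¹))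
    (Metric.ball_mem_nhds z (half_pos hz')) ?_ ?_ ?_ ?_ ?_ ?_).2
  · filter_upwards [Metric.ball_mem_nhds z (half_pos hz')] with w hw
    exact (integrable_mul_of_bounded hu hM
      (integrable_schwartzKernel (hball w hw))).aestronglyMeasurable
  · exact integrable_mul_of_bounded hu hM (integrable_schwartzKernel hz)
  · exact (integrable_mul_of_bounded hu hM (integrable_cauchyKernel_sq hz)).aestronglyMeasurable
  · refine Eventually.of_forall fun t w hw => ?_
    rw [norm_mul, norm_pow, norm_inv, Complex.norm_real, Real.norm_eq_abs]
    gcongr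
    · exact hM t
    have h1 : z.im ≤ ‖(t : ℂ) - z‖ := by
      have := Complex.abs_im_le_norm ((t : ℂ) - z)
      simp only [Complex.sub_im, Complex.ofReal_im, zero_sub, abs_neg] at this
      exact (le_abs_self _).trans this
    have h2 : ‖(t : ℂ) - z‖ - ‖w - z‖ ≤ ‖(t : ℂ) - w‖ := by
      have := norm_sub_norm_le ((t : ℂ) - z) (w - z)
      simpa using this
    have h3 : ‖w - z‖ < z.im / 2 := by rwa [← dist_eq_norm]
    have h4 : ‖(t : ℂ) - z‖ / 2 ≤ ‖(t : ℂ) - w‖ := by linarith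
    have h5 : 0 < ‖(t : ℂ) - z‖ := hz'.trans_le h1
    calc (‖(t : ℂ) - w‖⁻¹) ^ 2 ≤ ((‖(t : ℂ) - z‖ / 2)⁻¹) ^ 2 := by gcongr
      _ = 4 * (‖(t : ℂ) - z‖ ^ 2)⁻¹ := by
        field_simp
        norm_num
  · exact ((integrable_norm_sub_inv_sq hz).const_mul 4).const_mul M
  · refine Eventually.of_forall fun t w hw => HasDerivAt.const_mul _ ?_
    have h1 := sub_ne_zero_of_mem_upper (hball w hw) t
    have h2 := (((hasDerivAt_id w).const_sub (t : ℂ)).inv h1).sub_const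
      ((t / (t ^ 2 + 1) : ℝ) : ℂ)
    refine h2.congr_deriv ?_
    simp

theorem differentiableOn_complexSchwartz {u : ℝ → ℝ} (hu : Continuous u) {M : ℝ}
    (hM : ∀ t, |u t| ≤ M) : DifferentiableOn ℂ (complexSchwartz u) upper := fun _ hz =>
  (hasDerivAt_complexSchwartz hu hM hz).differentiableAt.differentiableWithinAt

/-- The antiderivative -1/(t - z) vanishes at both ends of the line. -/
theorem integral_cauchyKernel_sq {z : ℂ} (hz : z ∈ upper) :
    ∫ t : ℝ, (((t : ℂ) - z)⁻¹) ^ 2 = 0 := by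
  have hlim : Tendsto (fun t : ℝ => -((t : ℂ) - z)⁻¹) (cocompact ℝ) (𝓝 0) := by
    have h1 : Tendsto (fun t : ℝ => (t : ℂ) - z) (cocompact ℝ) (Bornology.cobounded ℂ) := by
      rw [← tendsto_norm_atTop_iff_cobounded]
      refine tendsto_atTop_mono (f := fun t : ℝ => ‖t‖ - ‖z‖) (fun t => ?_) ?_
      · have := norm_sub_norm_le (t : ℂ) z
        simpa using this
      · exact tendsto_atTop_add_const_right _ _ tendsto_norm_cocompact_atTop
    simpa using (tendsto_inv₀_cobounded.comp h1).neg
  have h := integral_of_hasDerivAt_of_tendsto (f := fun t : ℝ => -((t : ℂ) - z)⁻¹)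
    (f' := fun t : ℝ => (((t : ℂ) - z)⁻¹) ^ 2) (fun t => ?_) (integrable_cauchyKernel_sq hz)
    (hlim.mono_left atBot_le_cocompact) (hlim.mono_left atTop_le_cocompact)
  · simpa using h
  · have h1 := sub_ne_zero_of_mem_upper hz t
    have h2 := ((((hasDerivAt_id (t : ℂ)).sub_const z).inv h1).neg).comp_ofReal
    refine h2.congr_deriv ?_
    simp [neg_div]

/-- The derivative in z vanishes, so it is enough to evaluate at z = i, where the integral of i/(1 +
t²) is iπ. -/
theorem complexSchwartz_one {z : ℂ} (hz : z ∈ upper) : complexSchwartz (fun _ => 1) z = 1 := by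
  have hM : ∀ t : ℝ, |(fun _ : ℝ => (1 : ℝ)) t| ≤ 1 := by simp
  have h := isOpen_upper.is_const_of_deriv_eq_zero isPreconnected_upper
    (differentiableOn_complexSchwartz continuous_const hM) (fun w hw => by
      rw [(hasDerivAt_complexSchwartz continuous_const hM hw).deriv]
      simp only [Complex.ofReal_one, one_mul, integral_cauchyKernel_sq hw, mul_zero, Pi.zero_apply]) hz I_mem_upper
  rw [h, complexSchwartz]
  simp only [schwartzKernel_I, Complex.ofReal_one, one_mul]
  rw [integral_mul_const, integral_complex_ofReal, integral_univ_inv_one_add_sq]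
  have := Complex.I_ne_zero
  have : (Real.pi : ℂ) ≠ 0 := by exact_mod_cast Real.pi_ne_zero
  field_simp

/-- By (1 + tz)/((t² + 1)(t - z)) = 1/(t - z) - t/(t² + 1), the scalar part is the complex Schwartz
integrand; the ρ-coefficient is y times its derivative in z. -/
theorem schwartzIntegrand_toPlane (u : ℝ → ℝ) {z : ℂ} (hz : z ∈ upper) (t : ℝ) :
    schwartzIntegrand u (toPlane z) t
      = ((u t : ℂ) * schwartzKernel z t) • pair 1 0
        + ((u t : ℂ) * (((t : ℂ) - z)⁻¹) ^ 2) • pair 0 z.im := by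
  have h1 := sub_ne_zero_of_mem_upper hz t
  have h2 := ofReal_sq_add_one_ne t
  rw [schwartzIntegrand, toPlane_eq_pair, e₁_eq_pair, smul_pair, smul_pair, pair_add, pair_sub,
    mul_one, mul_zero, zero_sub, inverse_pair h1, pair_mul, smul_pair, smul_pair, smul_pair,
    pair_add, schwartzKernel]
  congr 1
  · push_cast
    field_simp
    ring
  · push_cast
    field_simp
    ring

theorem integrable_schwartzIntegrand {u : ℝ → ℝ} (hu : Continuous u) {M : ℝ}
    (hM : ∀ t, |u t| ≤ M) {z : ℂ} (hz : z ∈ upper) :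
    Integrable (schwartzIntegrand u (toPlane z)) := by
  have h1 := integrable_mul_of_bounded hu hM (integrable_schwartzKernel hz)
  have h2 := integrable_mul_of_bounded hu hM (integrable_cauchyKernel_sq hz)
  exact ((h1.smul_const (pair 1 0)).add (h2.smul_const (pair 0 z.im))).congr
    (Eventually.of_forall fun t => (schwartzIntegrand_toPlane u hz t).symm)

theorem schwartz_toPlane {u : ℝ → ℝ} (hu : Continuous u) {M : ℝ}
    (hM : ∀ t, |u t| ≤ M) {z : ℂ} (hz : z ∈ upper) :
    schwartz u (toPlane z)
      = pair (complexSchwartz u z) (z.im * deriv (complexSchwartz u) z) := by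
  have h1 := integrable_mul_of_bounded hu hM (integrable_schwartzKernel hz)
  have h2 := integrable_mul_of_bounded hu hM (integrable_cauchyKernel_sq hz)
  rw [schwartz, (hasDerivAt_complexSchwartz hu hM hz).deriv, complexSchwartz]
  simp_rw [schwartzIntegrand_toPlane u hz]
  rw [integral_add (h1.smul_const _) (h2.smul_const _), integral_smul_const, integral_smul_const,
    smul_pair, smul_pair, pair_add, smul_pair]
  congr 1 <;> ring

/-! ### Dini majorants and the Cauchy integral -/

/-- `g` is an integrable majorant of the Dini quotients of `v`, where `v` vanishes at infinity:
near `0` it dominates the oscillation of `v`, near infinity it dominates `v` itself. -/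
structure DiniMajorant (v g : ℝ → ℝ) : Prop where
  continuous : Continuous v
  tendsto : Tendsto v (cocompact ℝ) (𝓝 0)
  integrable : Integrable g
  near : ∀ x r, |r| < 1 → |v (x + r) - v x| ≤ g r * |r|
  far : ∀ r τ, 1 ≤ |r| → |r| ≤ |τ| → |v τ| ≤ g r * |r|

theorem exists_bound_of_tendsto_cocompact {u : ℝ → ℝ} (hu : Continuous u) {l : ℝ}
    (hl : Tendsto u (cocompact ℝ) (𝓝 l)) : ∃ M, ∀ t, |u t| ≤ M := by
  have h := (Metric.tendsto_nhds.1 hl) 1 one_pos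
  obtain ⟨K, hK, hKu⟩ := mem_cocompact.1 h
  obtain ⟨C, hC⟩ := hK.exists_bound_of_continuousOn hu.continuousOn
  refine ⟨max C (|l| + 1), fun t => ?_⟩
  by_cases ht : t ∈ K
  · exact (hC t ht).trans (le_max_left _ _)
  · have h1 : dist (u t) l < 1 := hKu ht
    rw [Real.dist_eq] at h1
    have h2 := abs_sub_abs_le_abs_sub (u t) l
    exact (by linarith : |u t| ≤ |l| + 1).trans (le_max_right _ _)

theorem exists_radius_of_tendsto_cocompact {v : ℝ → ℝ} (hv : Tendsto v (cocompact ℝ) (𝓝 0))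
    {ε : ℝ} (hε : 0 < ε) : ∃ T, ∀ t, T ≤ |t| → |v t| < ε := by
  have h := (Metric.tendsto_nhds.1 hv) ε hε
  rw [← Metric.cobounded_eq_cocompact, ← comap_norm_atTop, eventually_comap, eventually_atTop] at h
  obtain ⟨T, hT⟩ := h
  exact ⟨T, fun t ht => by simpa using hT |t| ht t rfl⟩

/-- For |t| ≥ 1 the field `far` at r = τ = t bounds the quotient by |g(t)|; for |t| < 1 boundedness
and 1 ≤ 2/(1 + t²) suffice. This dominates all far parts. -/
theorem DiniMajorant.integrable_weighted {v g : ℝ → ℝ} (h : DiniMajorant v g) :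
    Integrable fun t => |v t| / (1 + |t|) := by
  obtain ⟨M, hM⟩ := exists_bound_of_tendsto_cocompact h.continuous h.tendsto
  have hM0 : 0 ≤ M := (abs_nonneg _).trans (hM 0)
  refine (h.integrable.norm.add (integrable_inv_one_add_sq.const_mul (2 * M))).mono' ?_
    (Eventually.of_forall fun t => ?_)
  · exact (h.continuous.abs.div (by fun_prop) fun t => by positivity).aestronglyMeasurable
  rw [Real.norm_of_nonneg (by positivity), Pi.add_apply]
  rcases lt_or_ge |t| 1 with ht | ht
  · have h1 : |v t| / (1 + |t|) ≤ M := by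
      rw [div_le_iff₀ (by positivity)]
      nlinarith [hM t, abs_nonneg t]
    have h2 : M ≤ 2 * M * (1 + t ^ 2)⁻¹ := by
      rw [← div_eq_mul_inv, le_div_iff₀ (by positivity), ← sq_abs]
      nlinarith [abs_nonneg t, mul_nonneg hM0 (sub_nonneg.2 (pow_le_one₀ (n := 2) (abs_nonneg t) ht.le))]
    have := norm_nonneg (g t)
    linarith
  · have h1 := h.far t t ht le_rfl
    have h2 : |v t| / (1 + |t|) ≤ ‖g t‖ := by
      rw [div_le_iff₀ (by positivity)]
      have := le_abs_self (g t)
      rw [Real.norm_eq_abs]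
      nlinarith [abs_nonneg t, abs_nonneg (g t)]
    have : 0 ≤ 2 * M * (1 + t ^ 2)⁻¹ := by positivity
    linarith

theorem norm_cauchyKernel_le {z : ℂ} {t δ : ℝ} (hδ : 0 < δ) (h : δ ≤ ‖(t : ℂ) - z‖) :
    ‖((t : ℂ) - z)⁻¹‖ ≤ (1 + (1 + ‖z‖) / δ) / (1 + |t|) := by
  have h0 : 0 < ‖(t : ℂ) - z‖ := hδ.trans_le h
  have h1 : |t| ≤ ‖(t : ℂ) - z‖ + ‖z‖ := by
    have := norm_le_norm_sub_add (t : ℂ) z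
    simpa using this
  have h2 : 1 + ‖z‖ ≤ (1 + ‖z‖) / δ * ‖(t : ℂ) - z‖ := by
    rw [div_mul_eq_mul_div, le_div_iff₀ hδ]
    gcongr
  rw [norm_inv, inv_eq_one_div, div_le_div_iff₀ h0 (by positivity)]
  linarith

theorem norm_mul_cauchyKernel_le (v : ℝ → ℝ) {z : ℂ} {t δ C : ℝ} (hδ : 0 < δ)
    (h : δ ≤ ‖(t : ℂ) - z‖) (hC : 1 + (1 + ‖z‖) / δ ≤ C) :
    ‖(v t : ℂ) * ((t : ℂ) - z)⁻¹‖ ≤ C * (|v t| / (1 + |t|)) := by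
  rw [norm_mul, Complex.norm_real, Real.norm_eq_abs]
  calc |v t| * ‖((t : ℂ) - z)⁻¹‖ ≤ |v t| * (C / (1 + |t|)) := by
        gcongr
        exact (norm_cauchyKernel_le hδ h).trans (by gcongr)
    _ = C * (|v t| / (1 + |t|)) := by ring

theorem im_le_norm_sub {z : ℂ} (t : ℝ) : z.im ≤ ‖(t : ℂ) - z‖ := by
  have := Complex.abs_im_le_norm ((t : ℂ) - z)
  simp only [Complex.sub_im, Complex.ofReal_im, zero_sub, abs_neg] at this
  exact (le_abs_self _).trans this

theorem abs_sub_re_le_norm_sub {z : ℂ} (t : ℝ) : |t - z.re| ≤ ‖(t : ℂ) - z‖ := by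
  have := Complex.abs_re_le_norm ((t : ℂ) - z)
  simpa using this

theorem DiniMajorant.integrable_cauchy {v g : ℝ → ℝ} (h : DiniMajorant v g) {z : ℂ}
    (hz : z ∈ upper) : Integrable fun t : ℝ => (v t : ℂ) * ((t : ℂ) - z)⁻¹ :=
  (h.integrable_weighted.const_mul (1 + (1 + ‖z‖) / z.im)).mono'
    ((Complex.continuous_ofReal.comp h.continuous).mul
      (continuous_cauchyKernel hz)).aestronglyMeasurable
    (Eventually.of_forall fun t => norm_mul_cauchyKernel_le v hz (im_le_norm_sub t) le_rfl)

/-! ### Splitting the Cauchy integral around Re z -/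

/-- The Cauchy kernel centred at the real part of `z`. -/
def centredKernel (y r : ℝ) : ℂ := ((r : ℂ) - y * Complex.I)⁻¹

theorem centredKernel_eq (z : ℂ) (r : ℝ) :
    (((z.re + r : ℝ) : ℂ) - z)⁻¹ = centredKernel z.im r := by
  rw [centredKernel]
  congr 1
  apply Complex.ext <;> simp

theorem norm_centredKernel_le (y : ℝ) {r : ℝ} (hr : r ≠ 0) : ‖centredKernel y r‖ ≤ |r|⁻¹ := by
  rw [centredKernel, norm_inv]
  have h := Complex.abs_re_le_norm ((r : ℂ) - y * Complex.I)
  simp only [Complex.sub_re, Complex.ofReal_re, Complex.re_ofReal_mul, Complex.I_re, mul_zero,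
    sub_zero] at h
  gcongr

theorem continuous_centredKernel {y : ℝ} (hy : 0 < y) : Continuous (centredKernel y) := by
  have h := continuous_cauchyKernel (z := y * Complex.I) (by simpa [upper] using hy)
  exact h

theorem centredKernel_add_neg {y : ℝ} (hy : 0 < y) (r : ℝ) :
    centredKernel y r + centredKernel y (-r) = 2 * Complex.I * ((y / (r ^ 2 + y ^ 2) : ℝ) : ℂ) := by
  have hu : (y * Complex.I : ℂ) ∈ upper := by simpa [upper] using hy
  have h1 := sub_ne_zero_of_mem_upper hu r
  have h2 := sub_ne_zero_of_mem_upper hu (-r)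
  have h3 : (r : ℂ) ^ 2 + (y : ℂ) ^ 2 ≠ 0 := by
    have : ((r ^ 2 + y ^ 2 : ℝ) : ℂ) ≠ 0 := by
      rw [Complex.ofReal_ne_zero]
      positivity
    simpa using this
  have hI := Complex.I_sq
  rw [centredKernel, centredKernel]
  push_cast at h2 ⊢
  field_simp
  linear_combination (-2 * y * Complex.I) * ((y : ℂ) ^ 2) * hI

theorem integrableOn_centredKernel {y : ℝ} (hy : 0 < y) (a : ℝ) :
    IntegrableOn (centredKernel y) (Metric.ball 0 a) :=
  ((continuous_centredKernel hy).continuousOn.integrableOn_compact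
    (isCompact_closedBall (0 : ℝ) a)).mono_set Metric.ball_subset_closedBall

/-- The real part of the kernel is odd and drops out over a symmetric interval; the imaginary part
is the Poisson kernel. -/
theorem integral_centredKernel {y : ℝ} (hy : 0 < y) (a : ℝ) :
    ∫ r in Metric.ball 0 a, centredKernel y r
      = Complex.I * ((∫ r in Metric.ball (0 : ℝ) a, y / (r ^ 2 + y ^ 2) : ℝ) : ℂ) := by
  set f := (Metric.ball (0 : ℝ) a).indicator (centredKernel y) with hf
  have hfi : Integrable f := (integrableOn_centredKernel hy a).integrable_indicator measurableSet_ball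
  have h1 : ∫ r, f (-r) = ∫ r, f r := integral_neg_eq_self f volume
  have h2 : ∫ r, (f r + f (-r)) = (∫ r, f r) + ∫ r, f (-r) := integral_add hfi hfi.comp_neg
  have h3 : ∀ r, f r + f (-r) = (Metric.ball (0 : ℝ) a).indicator
      (fun r => 2 * Complex.I * ((y / (r ^ 2 + y ^ 2) : ℝ) : ℂ)) r := fun r => by
    by_cases hr : r ∈ Metric.ball (0 : ℝ) a
    · have hr' : -r ∈ Metric.ball (0 : ℝ) a := by simpa using hr
      rw [hf, Set.indicator_of_mem hr, Set.indicator_of_mem hr', Set.indicator_of_mem hr,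
        centredKernel_add_neg hy]
    · have hr' : -r ∉ Metric.ball (0 : ℝ) a := by simpa using hr
      rw [hf, Set.indicator_of_notMem hr, Set.indicator_of_notMem hr',
        Set.indicator_of_notMem hr, add_zero]
  simp_rw [h3] at h2
  rw [h1, integral_indicator measurableSet_ball, integral_const_mul, integral_complex_ofReal, hf,
    integral_indicator measurableSet_ball] at h2
  linear_combination -(1 / 2 : ℂ) * h2

theorem integral_ball_poisson_nonneg {y : ℝ} (hy : 0 < y) (a : ℝ) :
    0 ≤ ∫ r in Metric.ball (0 : ℝ) a, y / (r ^ 2 + y ^ 2) :=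
  integral_nonneg fun r => by positivity

theorem integral_ball_poisson_le {y : ℝ} (hy : 0 < y) (a : ℝ) :
    ∫ r in Metric.ball (0 : ℝ) a, y / (r ^ 2 + y ^ 2) ≤ Real.pi := by
  rw [← integral_poisson hy]
  exact setIntegral_le_integral (integrable_poisson hy)
    (Eventually.of_forall fun r => by positivity)

theorem integral_unit_ball_poisson {y : ℝ} (hy : 0 < y) :
    ∫ r in Metric.ball (0 : ℝ) 1, y / (r ^ 2 + y ^ 2) = 2 * Real.arctan y⁻¹ := by
  have h : ∀ r : ℝ, y / (r ^ 2 + y ^ 2) = y⁻¹ * (1 + (r / y) ^ 2)⁻¹ := fun r => by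
    have : r ^ 2 + y ^ 2 ≠ 0 := by positivity
    field_simp
    ring
  simp_rw [h]
  rw [Real.ball_eq_Ioo, ← integral_Ioc_eq_integral_Ioo, ← intervalIntegral.integral_of_le (by simp),
    intervalIntegral.integral_const_mul,
    intervalIntegral.inv_mul_integral_comp_div (f := fun s : ℝ => (1 + s ^ 2)⁻¹),
    integral_inv_one_add_sq, zero_sub, zero_add, neg_div, Real.arctan_neg, one_div]
  ring

theorem tendsto_integral_unit_ball_poisson :
    Tendsto (fun y : ℝ => ∫ r in Metric.ball (0 : ℝ) 1, y / (r ^ 2 + y ^ 2)) (𝓝[>] 0)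
      (𝓝 Real.pi) := by
  have h := ((Real.tendsto_arctan_atTop.mono_right nhdsWithin_le_nhds).comp
    (tendsto_inv_nhdsGT_zero (𝕜 := ℝ))).const_mul 2
  rw [mul_div_cancel₀ _ (two_ne_zero)] at h
  refine h.congr' ?_
  filter_upwards [self_mem_nhdsWithin] with y hy
  exact (integral_unit_ball_poisson hy).symm

/-- The part of the Cauchy integrand outside the interval of radius `a` around `z.re`. -/
def farPart (v : ℝ → ℝ) (a : ℝ) (z : ℂ) : ℝ → ℂ :=
  {t | a ≤ |t - z.re|}.indicator fun t => (v t : ℂ) * ((t : ℂ) - z)⁻¹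

/-- The regularized part of the Cauchy integrand inside the interval of radius `a` around
`z.re`, translated to the origin. -/
def nearPart (v : ℝ → ℝ) (a : ℝ) (z : ℂ) : ℝ → ℂ :=
  (Metric.ball (0 : ℝ) a).indicator fun r =>
    ((v (z.re + r) - v z.re : ℝ) : ℂ) * centredKernel z.im r

theorem measurableSet_far (a x : ℝ) : MeasurableSet {t : ℝ | a ≤ |t - x|} :=
  measurableSet_le measurable_const (by fun_prop)

/-- On the interval v(x) is subtracted to tame the kernel and then added back. The radius is left
free: boundary points and infinity need different choices. -/
theorem DiniMajorant.integral_cauchy_eq {v g : ℝ → ℝ} (h : DiniMajorant v g) {z : ℂ}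
    (hz : z ∈ upper) (a : ℝ) :
    ∫ t : ℝ, (v t : ℂ) * ((t : ℂ) - z)⁻¹ = (∫ t, farPart v a z t) + (∫ r, nearPart v a z r)
      + v z.re * (Complex.I *
        ((∫ r in Metric.ball (0 : ℝ) a, z.im / (r ^ 2 + z.im ^ 2) : ℝ) : ℂ)) := by
  have hz' : 0 < z.im := hz
  have hi := h.integrable_cauchy hz
  have hms := measurableSet_far a z.re
  have hsplit := integral_add_compl hms hi
  have hcompl : ∫ t in {t : ℝ | a ≤ |t - z.re|}ᶜ, (v t : ℂ) * ((t : ℂ) - z)⁻¹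
      = ∫ r in Metric.ball (0 : ℝ) a, (v (z.re + r) : ℂ) * centredKernel z.im r := by
    rw [← integral_indicator hms.compl, ← integral_indicator measurableSet_ball,
      ← integral_add_left_eq_self _ z.re]
    congr 1
    ext r
    by_cases hr : r ∈ Metric.ball (0 : ℝ) a
    · have hr' : z.re + r ∈ {t : ℝ | a ≤ |t - z.re|}ᶜ := by simpa using hr
      rw [Set.indicator_of_mem hr, Set.indicator_of_mem hr', centredKernel_eq]
    · have hr' : z.re + r ∉ {t : ℝ | a ≤ |t - z.re|}ᶜ := by simpa using hr
      rw [Set.indicator_of_notMem hr, Set.indicator_of_notMem hr']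
  have hci := integrableOn_centredKernel hz' a
  have hcv : IntegrableOn (fun r => (v (z.re + r) : ℂ) * centredKernel z.im r)
      (Metric.ball 0 a) := by
    have := (hi.comp_add_left z.re).integrableOn (s := Metric.ball 0 a)
    simpa only [centredKernel_eq] using this
  have hnear : ∫ r, nearPart v a z r
      = (∫ r in Metric.ball (0 : ℝ) a, (v (z.re + r) : ℂ) * centredKernel z.im r)
        - v z.re * ∫ r in Metric.ball (0 : ℝ) a, centredKernel z.im r := by
    rw [nearPart, integral_indicator measurableSet_ball, ← integral_const_mul,
      ← integral_sub hcv (hci.const_mul _)]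
    congr 1
    ext r
    push_cast
    ring
  rw [← hsplit, hcompl, hnear, farPart, integral_indicator hms, integral_centredKernel hz']
  ring

theorem DiniMajorant.aestronglyMeasurable_farPart {v g : ℝ → ℝ} (h : DiniMajorant v g) {z : ℂ}
    (hz : z ∈ upper) (a : ℝ) : AEStronglyMeasurable (farPart v a z) :=
  (h.integrable_cauchy hz).aestronglyMeasurable.indicator (measurableSet_far a z.re)

theorem DiniMajorant.aestronglyMeasurable_nearPart {v g : ℝ → ℝ} (h : DiniMajorant v g) {z : ℂ}
    (hz : z ∈ upper) (a : ℝ) : AEStronglyMeasurable (nearPart v a z) := by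
  have hv := h.continuous
  refine AEStronglyMeasurable.indicator (Continuous.aestronglyMeasurable ?_) measurableSet_ball
  refine Continuous.mul ?_ (continuous_centredKernel hz)
  fun_prop

theorem norm_nearPart_le {v : ℝ → ℝ} {r c : ℝ} {z : ℂ} (hr : r ≠ 0)
    (h : |v (z.re + r) - v z.re| ≤ c * |r|) :
    ‖((v (z.re + r) - v z.re : ℝ) : ℂ) * centredKernel z.im r‖ ≤ c := by
  have hr' : 0 < |r| := abs_pos.2 hr
  rw [norm_mul, Complex.norm_real, Real.norm_eq_abs]
  calc _ ≤ (c * |r|) * |r|⁻¹ := by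
        gcongr
        · exact (abs_nonneg _).trans h
        · exact norm_centredKernel_le _ hr
    _ = c := by field_simp

theorem nearPart_zero (v : ℝ → ℝ) (a : ℝ) (z : ℂ) : nearPart v a z 0 = 0 := by
  by_cases h : (0 : ℝ) ∈ Metric.ball (0 : ℝ) a
  · rw [nearPart, Set.indicator_of_mem h]
    simp
  · rw [nearPart, Set.indicator_of_notMem h]

/-! ### Limits at points of the real line -/

theorem DiniMajorant.tendsto_farPart_boundary {v g : ℝ → ℝ} (h : DiniMajorant v g) (x₀ : ℝ) :
    Tendsto (fun z : ℂ => ∫ t, farPart v 1 z t) (𝓝[upper] (x₀ : ℂ))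
      (𝓝 (∫ t, farPart v 1 (x₀ : ℂ) t)) := by
  have hball : ∀ᶠ z : ℂ in 𝓝[upper] (x₀ : ℂ), ‖z - x₀‖ < 1 := by
    refine eventually_nhdsWithin_of_eventually_nhds ?_
    filter_upwards [Metric.ball_mem_nhds (x₀ : ℂ) one_pos] with z hz
    rwa [← dist_eq_norm]
  have hre : Tendsto (fun z : ℂ => z.re) (𝓝[upper] (x₀ : ℂ)) (𝓝 x₀) := by
    have := (Complex.continuous_re.tendsto (x₀ : ℂ)).mono_left
      (nhdsWithin_le_nhds (s := upper))
    simpa using this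
  refine tendsto_integral_filter_of_dominated_convergence
    -- The far kernel bound with distance δ = 1 and |z| ≤ 1 + |x₀|, valid when |z - x₀| < 1.
    (fun t => (1 + (1 + (1 + |x₀|)) / 1) * (|v t| / (1 + |t|))) ?_ ?_
    (h.integrable_weighted.const_mul _) ?_
  · filter_upwards [self_mem_nhdsWithin] with z hz using h.aestronglyMeasurable_farPart hz 1
  · filter_upwards [hball] with z hz
    refine Eventually.of_forall fun t => ?_
    by_cases ht : t ∈ {t : ℝ | 1 ≤ |t - z.re|}
    · rw [farPart, Set.indicator_of_mem ht]
      refine norm_mul_cauchyKernel_le v one_pos (ht.trans (abs_sub_re_le_norm_sub t)) ?_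
      have h1 := norm_le_norm_sub_add z (x₀ : ℂ)
      rw [Complex.norm_real, Real.norm_eq_abs] at h1
      gcongr
      linarith
    · rw [farPart, Set.indicator_of_notMem ht, norm_zero]
      positivity
  -- At the endpoints x₀ ± 1 the indicator need not converge; they form a null set.
  · have hfin : ∀ᵐ t : ℝ, t ∉ ({x₀ - 1, x₀ + 1} : Set ℝ) :=
      measure_eq_zero_iff_ae_notMem.1 ((Set.toFinite _).measure_zero volume)
    filter_upwards [hfin] with t ht
    have hcont : Tendsto (fun z : ℂ => |t - z.re|) (𝓝[upper] (x₀ : ℂ)) (𝓝 |t - x₀|) :=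
      (hre.const_sub t).abs
    rcases lt_trichotomy |t - x₀| 1 with h1 | h1 | h1
    · have h2 : farPart v 1 (x₀ : ℂ) t = 0 := by
        rw [farPart, Set.indicator_of_notMem (by simpa using h1)]
      rw [h2]
      refine tendsto_const_nhds.congr' ?_
      filter_upwards [hcont.eventually_lt_const h1] with z hz
      rw [farPart, Set.indicator_of_notMem (by simpa using hz)]
    · exfalso
      apply ht
      rcases (abs_eq one_pos.le).1 h1 with h2 | h2
      · right
        simp
        linarith
      · left
        linarith
    · have h2 : farPart v 1 (x₀ : ℂ) t = (v t : ℂ) * ((t : ℂ) - x₀)⁻¹ := by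
        rw [farPart, Set.indicator_of_mem (by simpa using h1.le)]
      rw [h2]
      have hne : (t : ℂ) - x₀ ≠ 0 := by
        rw [← Complex.ofReal_sub, Complex.ofReal_ne_zero]
        intro h0
        rw [h0, abs_zero] at h1
        linarith
      have hlim : Tendsto (fun z : ℂ => (v t : ℂ) * ((t : ℂ) - z)⁻¹) (𝓝[upper] (x₀ : ℂ))
          (𝓝 ((v t : ℂ) * ((t : ℂ) - x₀)⁻¹)) :=
        (((tendsto_nhdsWithin_of_tendsto_nhds tendsto_id).const_sub _).inv₀ hne).const_mul _
      refine hlim.congr' ?_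
      filter_upwards [hcont.eventually_const_lt h1] with z hz
      rw [farPart, Set.indicator_of_mem (by simpa using hz.le)]

theorem DiniMajorant.tendsto_nearPart_boundary {v g : ℝ → ℝ} (h : DiniMajorant v g) (x₀ : ℝ) :
    Tendsto (fun z : ℂ => ∫ r, nearPart v 1 z r) (𝓝[upper] (x₀ : ℂ))
      (𝓝 (∫ r, nearPart v 1 (x₀ : ℂ) r)) := by
  refine tendsto_integral_filter_of_dominated_convergence (fun r => ‖g r‖) ?_ ?_
    h.integrable.norm ?_
  · filter_upwards [self_mem_nhdsWithin] with z hz using h.aestronglyMeasurable_nearPart hz 1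
  · refine Eventually.of_forall fun z => Eventually.of_forall fun r => ?_
    rcases eq_or_ne r 0 with rfl | hr0
    · rw [nearPart_zero, norm_zero]
      exact norm_nonneg _
    by_cases hr : r ∈ Metric.ball (0 : ℝ) 1
    · rw [nearPart, Set.indicator_of_mem hr]
      have hr1 : |r| < 1 := by simpa using hr
      exact (norm_nearPart_le hr0 (h.near z.re r hr1)).trans (le_abs_self _)
    · rw [nearPart, Set.indicator_of_notMem hr, norm_zero]
      exact norm_nonneg _
  · refine Eventually.of_forall fun r => ?_
    rcases eq_or_ne r 0 with rfl | hr0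
    · simp only [nearPart_zero]
      exact tendsto_const_nhds
    by_cases hr : r ∈ Metric.ball (0 : ℝ) 1
    · simp only [nearPart, Set.indicator_of_mem hr]
      have hv := h.continuous
      have hne : (r : ℂ) - ((x₀ : ℂ).im : ℂ) * Complex.I ≠ 0 := by simpa using hr0
      refine ContinuousAt.continuousWithinAt (ContinuousAt.mul ?_ (ContinuousAt.inv₀ ?_ hne))
      · refine Continuous.continuousAt ?_
        have := Complex.continuous_re
        fun_prop
      · refine Continuous.continuousAt ?_
        have := Complex.continuous_im
        fun_prop
    · simp only [nearPart, Set.indicator_of_notMem hr]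
      exact tendsto_const_nhds

theorem DiniMajorant.tendsto_cauchy_boundary {v g : ℝ → ℝ} (h : DiniMajorant v g) (x₀ : ℝ) :
    ∃ R : ℝ, Tendsto (fun z => ∫ t : ℝ, (v t : ℂ) * ((t : ℂ) - z)⁻¹) (𝓝[upper] (x₀ : ℂ))
      (𝓝 (R + v x₀ * (Complex.I * Real.pi))) := by
  have hre : Tendsto (fun z : ℂ => z.re) (𝓝[upper] (x₀ : ℂ)) (𝓝 x₀) := by
    have := (Complex.continuous_re.tendsto (x₀ : ℂ)).mono_left
      (nhdsWithin_le_nhds (s := upper))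
    simpa using this
  have him : Tendsto (fun z : ℂ => z.im) (𝓝[upper] (x₀ : ℂ)) (𝓝[>] 0) := by
    rw [tendsto_nhdsWithin_iff]
    refine ⟨?_, self_mem_nhdsWithin⟩
    have := (Complex.continuous_im.tendsto (x₀ : ℂ)).mono_left
      (nhdsWithin_le_nhds (s := upper))
    simpa using this
  have hv : Tendsto (fun z : ℂ => (v z.re : ℂ)) (𝓝[upper] (x₀ : ℂ)) (𝓝 (v x₀)) :=
    (Complex.continuous_ofReal.tendsto _).comp ((h.continuous.tendsto x₀).comp hre)
  have hP := (Complex.continuous_ofReal.tendsto _).comp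
    (tendsto_integral_unit_ball_poisson.comp him)
  have hlim := ((h.tendsto_farPart_boundary x₀).add (h.tendsto_nearPart_boundary x₀)).add
    (hv.mul (hP.const_mul Complex.I))
  -- At z = x₀ both integrands are real. This makes `R` real, so that it contributes only to the
  -- imaginary part of S.
  have hfar : ∀ t, farPart v 1 (x₀ : ℂ) t
      = (({t : ℝ | 1 ≤ |t - x₀|}.indicator (fun t => v t * (t - x₀)⁻¹) t : ℝ) : ℂ) := fun t => by
    simp only [farPart, Set.indicator_apply, Complex.ofReal_re]
    split_ifs <;> simp
  have hnear : ∀ r, nearPart v 1 (x₀ : ℂ) r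
      = (((Metric.ball (0 : ℝ) 1).indicator (fun r => (v (x₀ + r) - v x₀) * r⁻¹) r : ℝ) : ℂ) :=
    fun r => by
      by_cases hr : r ∈ Metric.ball (0 : ℝ) 1
      · rw [nearPart, Set.indicator_of_mem hr, Set.indicator_of_mem hr, centredKernel]
        simp
      · rw [nearPart, Set.indicator_of_notMem hr, Set.indicator_of_notMem hr, Complex.ofReal_zero]
  simp_rw [hfar, hnear, integral_complex_ofReal, ← Complex.ofReal_add] at hlim
  refine ⟨_, hlim.congr' ?_⟩
  filter_upwards [self_mem_nhdsWithin] with z hz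
  rw [h.integral_cauchy_eq hz 1]
  rfl

/-! ### Limit at infinity -/

theorem isCountablyGenerated_cocompact : (cocompact ℂ).IsCountablyGenerated := by
  rw [← Metric.cobounded_eq_cocompact, ← comap_norm_atTop]
  infer_instance

/-- The reason for the radius |x| - |z|/2: both x and x + r stay at distance at least |z|/2 ≥ |r|
from 0, so for |r| ≥ 1 the field `far` controls v at both. -/
theorem abs_add_ge_of_near {z : ℂ} {r : ℝ} (hr : |r| < |z.re| - ‖z‖ / 2) :
    ‖z‖ / 2 ≤ |z.re + r| ∧ ‖z‖ / 2 ≤ |z.re| ∧ |r| ≤ ‖z‖ / 2 := by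
  have h1 := abs_sub_abs_le_abs_sub z.re (-r)
  rw [abs_neg, sub_neg_eq_add] at h1
  have h2 := Complex.abs_re_le_norm z
  have h3 := abs_nonneg r
  exact ⟨by linarith, by linarith, by linarith⟩

/-- If |x| ≥ 3|z|/4, the horizontal distance is at least |z|/4; otherwise Im z is. -/
theorem norm_sub_ge_of_far {z : ℂ} {t : ℝ} (hz : z ∈ upper) (ht : |z.re| - ‖z‖ / 2 ≤ |t - z.re|) :
    ‖z‖ / 4 ≤ ‖(t : ℂ) - z‖ := by
  have hz' : 0 < z.im := hz
  have h1 := Complex.norm_le_abs_re_add_abs_im z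
  have h2 := im_le_norm_sub (z := z) t
  have h3 := abs_sub_re_le_norm_sub (z := z) t
  rw [abs_of_pos hz'] at h1
  rcases le_total (3 / 4 * ‖z‖) |z.re| with h | h <;> linarith

theorem eventually_norm_ge_infty (R : ℝ) : ∀ᶠ z in cocompact ℂ ⊓ 𝓟 upper, R ≤ ‖z‖ := by
  have h : Tendsto (fun z : ℂ => ‖z‖) (cocompact ℂ ⊓ 𝓟 upper) atTop :=
    (tendsto_norm_cocompact_atTop (E := ℂ)).mono_left inf_le_left
  exact h.eventually_ge_atTop R

theorem eventually_mem_upper_infty : ∀ᶠ z in cocompact ℂ ⊓ 𝓟 upper, z ∈ upper :=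
  eventually_inf_principal.2 (Eventually.of_forall fun _ h => h)

theorem DiniMajorant.tendsto_farPart_infty {v g : ℝ → ℝ} (h : DiniMajorant v g) :
    Tendsto (fun z : ℂ => ∫ t, farPart v (|z.re| - ‖z‖ / 2) z t) (cocompact ℂ ⊓ 𝓟 upper)
      (𝓝 0) := by
  have := isCountablyGenerated_cocompact
  rw [← integral_zero ℝ ℂ (μ := volume)]
  refine tendsto_integral_filter_of_dominated_convergence
    -- 9 = 1 + 8, where (1 + |z|)/(|z|/4) ≤ 8 as soon as |z| ≥ 1.
    (fun t => 9 * (|v t| / (1 + |t|))) ?_ ?_ (h.integrable_weighted.const_mul _) ?_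
  · filter_upwards [eventually_mem_upper_infty] with z hz using h.aestronglyMeasurable_farPart hz _
  · filter_upwards [eventually_mem_upper_infty, eventually_norm_ge_infty 1] with z hz hz1
    refine Eventually.of_forall fun t => ?_
    by_cases ht : t ∈ {t : ℝ | |z.re| - ‖z‖ / 2 ≤ |t - z.re|}
    · rw [farPart, Set.indicator_of_mem ht]
      refine norm_mul_cauchyKernel_le v (by positivity) (norm_sub_ge_of_far hz ht) ?_
      have : (1 + ‖z‖) / (‖z‖ / 4) ≤ 8 := by
        rw [div_le_iff₀ (by positivity)]
        linarith
      linarith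
    · rw [farPart, Set.indicator_of_notMem ht, norm_zero]
      positivity
  · refine Eventually.of_forall fun t => ?_
    have h1 : Tendsto (fun z : ℂ => |v t| * (4 * ‖z‖⁻¹)) (cocompact ℂ ⊓ 𝓟 upper)
        (𝓝 (|v t| * (4 * 0))) :=
      ((tendsto_inv_atTop_zero.comp ((tendsto_norm_cocompact_atTop (E := ℂ)).mono_left
        inf_le_left)).const_mul 4).const_mul _
    rw [mul_zero, mul_zero] at h1
    refine squeeze_zero_norm' ?_ h1
    filter_upwards [eventually_mem_upper_infty, eventually_norm_ge_infty 1] with z hz hz1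
    by_cases ht : t ∈ {t : ℝ | |z.re| - ‖z‖ / 2 ≤ |t - z.re|}
    · rw [farPart, Set.indicator_of_mem ht, norm_mul, norm_inv, Complex.norm_real,
        Real.norm_eq_abs]
      gcongr
      have h2 := norm_sub_ge_of_far hz ht
      calc ‖(t : ℂ) - z‖⁻¹ ≤ (‖z‖ / 4)⁻¹ := by gcongr
        _ = 4 * ‖z‖⁻¹ := by rw [inv_div, div_eq_mul_inv]
    · rw [farPart, Set.indicator_of_notMem ht, norm_zero]
      positivity

theorem DiniMajorant.tendsto_nearPart_infty {v g : ℝ → ℝ} (h : DiniMajorant v g) :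
    Tendsto (fun z : ℂ => ∫ r, nearPart v (|z.re| - ‖z‖ / 2) z r) (cocompact ℂ ⊓ 𝓟 upper)
      (𝓝 0) := by
  have := isCountablyGenerated_cocompact
  rw [← integral_zero ℝ ℂ (μ := volume)]
  -- The factor 2 is needed for |r| ≥ 1, where v(x + r) and v(x) are bounded separately.
  refine tendsto_integral_filter_of_dominated_convergence (fun r => 2 * ‖g r‖) ?_ ?_
    (h.integrable.norm.const_mul 2) ?_
  · filter_upwards [eventually_mem_upper_infty] with z hz using h.aestronglyMeasurable_nearPart hz _
  · refine Eventually.of_forall fun z => Eventually.of_forall fun r => ?_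
    rcases eq_or_ne r 0 with rfl | hr0
    · rw [nearPart_zero, norm_zero]
      positivity
    by_cases hr : r ∈ Metric.ball (0 : ℝ) (|z.re| - ‖z‖ / 2)
    · rw [nearPart, Set.indicator_of_mem hr]
      obtain ⟨h1, h2, h3⟩ := abs_add_ge_of_near (by simpa using hr)
      refine norm_nearPart_le hr0 ?_
      have hg : g r * |r| ≤ ‖g r‖ * |r| := by
        gcongr
        exact le_abs_self _
      have hg0 : 0 ≤ ‖g r‖ * |r| := by positivity
      rcases lt_or_ge |r| 1 with hr1 | hr1
      · have := h.near z.re r hr1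
        linarith
      · have h4 := h.far r (z.re + r) hr1 (h3.trans h1)
        have h5 := h.far r z.re hr1 (h3.trans h2)
        have h6 := abs_sub (v (z.re + r)) (v z.re)
        linarith
    · rw [nearPart, Set.indicator_of_notMem hr, norm_zero]
      positivity
  · refine Eventually.of_forall fun r => ?_
    rcases eq_or_ne r 0 with rfl | hr0
    · simp only [nearPart_zero]
      exact tendsto_const_nhds
    have hr' : 0 < |r| := abs_pos.2 hr0
    rw [Metric.tendsto_nhds]
    intro ε hε
    obtain ⟨T, hT⟩ := exists_radius_of_tendsto_cocompact h.tendsto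
      (ε := ε / 4 * |r|) (by positivity)
    filter_upwards [eventually_norm_ge_infty (2 * T)] with z hz
    rw [dist_zero_right]
    by_cases hr : r ∈ Metric.ball (0 : ℝ) (|z.re| - ‖z‖ / 2)
    · rw [nearPart, Set.indicator_of_mem hr]
      obtain ⟨h1, h2, h3⟩ := abs_add_ge_of_near (by simpa using hr)
      have h4 := hT (z.re + r) (by linarith)
      have h5 := hT z.re (by linarith)
      have h6 := abs_sub (v (z.re + r)) (v z.re)
      refine (norm_nearPart_le (c := ε / 2) hr0 (by linarith)).trans_lt (by linarith)
    · rw [nearPart, Set.indicator_of_notMem hr, norm_zero]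
      exact hε

theorem DiniMajorant.tendsto_cauchy_infty {v g : ℝ → ℝ} (h : DiniMajorant v g) :
    Tendsto (fun z => ∫ t : ℝ, (v t : ℂ) * ((t : ℂ) - z)⁻¹) (cocompact ℂ ⊓ 𝓟 upper)
      (𝓝 0) := by
  have hP : Tendsto (fun z : ℂ => (v z.re : ℂ) * (Complex.I *
      ((∫ r in Metric.ball (0 : ℝ) (|z.re| - ‖z‖ / 2), z.im / (r ^ 2 + z.im ^ 2) : ℝ) : ℂ)))
      (cocompact ℂ ⊓ 𝓟 upper) (𝓝 0) := by
    rw [Metric.tendsto_nhds]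
    intro ε hε
    have hpi := Real.pi_pos
    obtain ⟨T, hT⟩ := exists_radius_of_tendsto_cocompact h.tendsto
      (ε := ε / (2 * Real.pi)) (by positivity)
    filter_upwards [eventually_norm_ge_infty (2 * T), eventually_mem_upper_infty] with z hz hzu
    rw [dist_zero_right]
    -- For steep z the interval is empty. Otherwise |x| ≥ |z|/2 is large, so v(x) is small while the
    -- Poisson mass is at most π.
    rcases le_or_gt (|z.re| - ‖z‖ / 2) 0 with ha | ha
    · rw [Metric.ball_eq_empty.2 ha]
      simpa using hε
    · have h1 := hT z.re (by linarith)
      rw [norm_mul, norm_mul, Complex.norm_I, one_mul, Complex.norm_real, Complex.norm_real,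
        Real.norm_eq_abs, Real.norm_of_nonneg (integral_ball_poisson_nonneg hzu _)]
      calc _ ≤ ε / (2 * Real.pi) * Real.pi :=
            mul_le_mul h1.le (integral_ball_poisson_le hzu _)
              (integral_ball_poisson_nonneg hzu _) (by positivity)
        _ = ε / 2 := by field_simp
        _ < ε := by linarith
  have hlim := (h.tendsto_farPart_infty.add h.tendsto_nearPart_infty).add hP
  rw [add_zero, add_zero] at hlim
  refine hlim.congr' ?_
  filter_upwards [eventually_mem_upper_infty] with z hz
  exact (h.integral_cauchy_eq hz _).symm

/-! ### Majorants from the Dini conditions -/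

theorem integrable_comp_abs {G : ℝ → ℝ} (hG : IntegrableOn G (Set.Ioi 0)) :
    Integrable fun r => G |r| := by
  have h1 : IntegrableOn (fun r => G |r|) (Set.Ioi 0) :=
    hG.congr_fun (fun r hr => by rw [abs_of_pos hr]) measurableSet_Ioi
  have h2 : IntegrableOn (fun r => G |r|) (Set.Iio 0) := by
    have := h1.comp_neg
    simpa using this
  have h3 : IntegrableOn (fun r => G |r|) (Set.Iic 0) :=
    (integrableOn_Iic_iff_integrableOn_Iio (by simp)).2 h2
  have := h3.union h1
  rwa [Set.Iic_union_Ioi, integrableOn_univ] at this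

theorem integrableOn_toReal_div {ω : ℝ → ℝ≥0∞} (hm : MonotoneOn ω (Set.Ioc 0 1)) (hD : Dini ω) :
    IntegrableOn (fun η => (ω η).toReal / η) (Set.Ioc 0 1) := by
  have hmeas : AEMeasurable ω (volume.restrict (Set.Ioc 0 1)) :=
    aemeasurable_restrict_of_monotoneOn measurableSet_Ioc hm
  have hmeas' : AEMeasurable (fun η => ω η / ENNReal.ofReal η) (volume.restrict (Set.Ioc 0 1)) :=
    hmeas.div (by fun_prop)
  refine (integrable_toReal_of_lintegral_ne_top hmeas' hD.ne).congr ?_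
  filter_upwards [ae_restrict_mem measurableSet_Ioc] with η hη
  rw [ENNReal.toReal_div, ENNReal.toReal_ofReal hη.1.le]

/-- The substitution η = 1/ρ turns dη/η into dρ/ρ up to orientation, so the Dini condition at
infinity becomes integrability over large radii. -/
theorem integrableOn_Ioi_of_inv {f : ℝ → ℝ} (h : IntegrableOn (fun η => f η / η) (Set.Ioc 0 1)) :
    IntegrableOn (fun ρ => f ρ⁻¹ / ρ) (Set.Ici 1) := by
  have himg : (fun ρ : ℝ => ρ⁻¹) '' Set.Ici 1 = Set.Ioc 0 1 := by
    ext η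
    constructor
    · rintro ⟨ρ, hρ, rfl⟩
      have hρ1 : (1 : ℝ) ≤ ρ := hρ
      exact ⟨by positivity, inv_le_one_of_one_le₀ hρ1⟩
    · rintro ⟨h0, h1⟩
      exact ⟨η⁻¹, (one_le_inv₀ h0).2 h1, inv_inv η⟩
  rw [← himg, integrableOn_image_iff_integrableOn_abs_deriv_smul measurableSet_Ici
    (f' := fun ρ => -(ρ ^ 2)⁻¹) (fun ρ hρ => (hasDerivAt_inv (by
      have : (1 : ℝ) ≤ ρ := hρ
      positivity)).hasDerivWithinAt) (inv_injective.injOn)] at h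
  refine h.congr_fun (fun ρ hρ => ?_) measurableSet_Ici
  have hρ1 : (1 : ℝ) ≤ ρ := hρ
  have hρ0 : ρ ≠ 0 := by positivity
  simp only [abs_neg, smul_eq_mul]
  rw [abs_of_pos (by positivity)]
  field_simp

theorem monotone_modulus (u : ℝ → ℝ) : Monotone (modulus u) := fun _ _ h =>
  iSup₂_mono fun _ _ => iSup_mono' fun h' => ⟨h'.trans h, le_rfl⟩

theorem monotoneOn_modulusInfty (u : ℝ → ℝ) (l : ℝ) :
    MonotoneOn (modulusInfty u l) (Set.Ioc 0 1) := fun _ ha _ _ h =>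
  iSup_mono fun _ => iSup_mono' fun h' => ⟨(one_div_le_one_div_of_le ha.1 h).trans h', le_rfl⟩

theorem abs_sub_le_modulus {u : ℝ → ℝ} {M : ℝ} (hM : ∀ t, |u t| ≤ M) {τ₁ τ₂ ε : ℝ}
    (h : |τ₁ - τ₂| ≤ ε) : |u τ₁ - u τ₂| ≤ (modulus u ε).toReal := by
  have hfin : modulus u ε ≤ ENNReal.ofReal (2 * M) :=
    iSup₂_le fun a b => iSup_le fun _ => ENNReal.ofReal_le_ofReal (by
      have := abs_sub (u a) (u b)
      linarith [hM a, hM b])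
  refine (ENNReal.ofReal_le_iff_le_toReal (hfin.trans_lt ENNReal.ofReal_lt_top).ne).1 ?_
  exact le_iSup₂_of_le τ₁ τ₂ (le_iSup_of_le h le_rfl)

theorem abs_sub_le_modulusInfty {u : ℝ → ℝ} {M l : ℝ} (hM : ∀ t, |u t| ≤ M) {τ ε : ℝ}
    (h : 1 / ε ≤ |τ|) : |u τ - l| ≤ (modulusInfty u l ε).toReal := by
  have hfin : modulusInfty u l ε ≤ ENNReal.ofReal (M + |l|) :=
    iSup_le fun a => iSup_le fun _ => ENNReal.ofReal_le_ofReal (by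
      have := abs_sub (u a) l
      linarith [hM a])
  refine (ENNReal.ofReal_le_iff_le_toReal (hfin.trans_lt ENNReal.ofReal_lt_top).ne).1 ?_
  exact le_iSup_of_le τ (le_iSup_of_le h le_rfl)

theorem exists_diniMajorant {u : ℝ → ℝ} {l : ℝ} (hu : Continuous u)
    (hl : Tendsto u (cocompact ℝ) (𝓝 l)) (hd : Dini (modulus u))
    (hi : Dini (modulusInfty u l)) : ∃ g, DiniMajorant (fun t => u t - l) g := by
  obtain ⟨M, hM⟩ := exists_bound_of_tendsto_cocompact hu hl
  have h1 := integrableOn_toReal_div ((monotone_modulus u).monotoneOn _) hd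
  have h2 := integrableOn_Ioi_of_inv (f := fun η => (modulusInfty u l η).toReal)
    (integrableOn_toReal_div (monotoneOn_modulusInfty u l) hi)
  -- The oscillation modulus serves radii below 1, the modulus at infinity, taken at 1/r, the
  -- others.
  set G : ℝ → ℝ := fun r => if r < 1 then (modulus u r).toReal / r
    else (modulusInfty u l r⁻¹).toReal / r with hG
  have hGi : IntegrableOn G (Set.Ioi 0) := by
    have h3 : IntegrableOn G (Set.Ioo 0 1) :=
      (h1.mono_set Set.Ioo_subset_Ioc_self).congr_fun
        (fun r hr => by simp only [hG, if_pos hr.2]) measurableSet_Ioo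
    have h4 : IntegrableOn G (Set.Ici 1) :=
      h2.congr_fun (fun r hr => by simp only [hG, if_neg (not_lt.2 (Set.mem_Ici.1 hr))]) measurableSet_Ici
    have := h3.union h4
    rwa [Set.Ioo_union_Ici_eq_Ioi one_pos] at this
  refine ⟨fun r => G |r|, hu.sub continuous_const, ?_, integrable_comp_abs hGi, ?_, ?_⟩
  · simpa using hl.sub_const l
  · intro x r hr
    rcases eq_or_ne r 0 with rfl | hr0
    · simp
    have hr' : 0 < |r| := abs_pos.2 hr0
    simp only [hG, if_pos hr]
    rw [div_mul_cancel₀ _ hr'.ne', sub_sub_sub_cancel_right]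
    exact abs_sub_le_modulus hM (by simp)
  · intro r τ hr hτ
    simp only [hG, if_neg (not_lt.2 hr)]
    rw [div_mul_cancel₀ _ (by positivity)]
    exact abs_sub_le_modulusInfty hM (by simpa using hτ)

/-! ### Boundary values of the Schwartz integral and assembly -/

/-- Density 1 reproduces 1, so l can be split off. For u - l the correction t/(t² + 1) integrates
separately to a real `c`, which after division by πi does not affect real parts. -/
theorem complexSchwartz_eq {u : ℝ → ℝ} {l : ℝ} (hu : Continuous u) {M : ℝ}
    (hM : ∀ t, |u t| ≤ M) {g : ℝ → ℝ} (h : DiniMajorant (fun t => u t - l) g) :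
    ∃ c : ℝ, ∀ z ∈ upper, complexSchwartz u z = (1 / (Real.pi * Complex.I)) *
      ((∫ t : ℝ, ((u t - l : ℝ) : ℂ) * ((t : ℂ) - z)⁻¹) - c) + l := by
  refine ⟨∫ t : ℝ, (u t - l) * (t / (t ^ 2 + 1)), fun z hz => ?_⟩
  have h1 := h.integrable_cauchy hz
  have hk := integrable_schwartzKernel hz
  have h2 := integrable_mul_of_bounded hu hM hk
  have h3 := hk.const_mul (l : ℂ)
  have h4 := complexSchwartz_one hz
  rw [complexSchwartz] at h4 ⊢
  simp only [Complex.ofReal_one, one_mul] at h4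
  have h5 : ∫ t : ℝ, (u t : ℂ) * schwartzKernel z t
      = (∫ t : ℝ, ((u t - l : ℝ) : ℂ) * schwartzKernel z t) + l * ∫ t, schwartzKernel z t := by
    rw [← integral_const_mul, ← integral_add _ h3]
    · congr 1
      ext t
      push_cast
      ring
    · refine (h2.sub h3).congr (Eventually.of_forall fun t => ?_)
      simp
      ring
  have h6 : Integrable fun t : ℝ => ((u t - l : ℝ) : ℂ) * schwartzKernel z t := by
    refine (h2.sub h3).congr (Eventually.of_forall fun t => ?_)
    simp
    ring
  have h7 : ∫ t : ℝ, ((u t - l : ℝ) : ℂ) * schwartzKernel z t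
      = (∫ t : ℝ, ((u t - l : ℝ) : ℂ) * ((t : ℂ) - z)⁻¹)
        - ((∫ t : ℝ, (u t - l) * (t / (t ^ 2 + 1)) : ℝ) : ℂ) := by
    rw [← integral_complex_ofReal, eq_sub_iff_add_eq, ← integral_add h6]
    · congr 1
      ext t
      rw [schwartzKernel]
      push_cast
      ring
    · refine (h1.sub h6).congr (Eventually.of_forall fun t => ?_)
      simp [schwartzKernel]
      ring
  rw [h5, h7, mul_add]
  linear_combination (l : ℂ) * h4

/-- The Schwartz integral of a Dini function extends continuously to the closed half-plane
including infinity, and the real part of its boundary value is the density. -/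
theorem exists_continuous_extension {u : ℝ → ℝ} {l : ℝ} (hu : Continuous u)
    (hl : Tendsto u (cocompact ℝ) (𝓝 l)) (hd : Dini (modulus u)) (hi : Dini (modulusInfty u l)) :
    ∃ S : ℂ → ℂ, Set.EqOn S (complexSchwartz u) upper ∧ ContinuousOn S (closure upper) ∧
      (∃ L, Tendsto S (cocompact ℂ ⊓ 𝓟 upper) (𝓝 L)) ∧ ∀ x : ℝ, (S x).re = u x := by
  obtain ⟨M, hM⟩ := exists_bound_of_tendsto_cocompact hu hl
  obtain ⟨g, hg⟩ := exists_diniMajorant hu hl hd hi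
  obtain ⟨c, hc⟩ := complexSchwartz_eq hu hM hg
  have hdiff := differentiableOn_complexSchwartz hu hM
  have hpi : (Real.pi : ℂ) ≠ 0 := by exact_mod_cast Real.pi_ne_zero
  have hI := Complex.I_ne_zero
  have hbd : ∀ x : ℝ, ∃ y : ℂ, y.re = u x ∧
      Tendsto (complexSchwartz u) (𝓝[upper] (x : ℂ)) (𝓝 y) := by
    intro x
    obtain ⟨R, hR⟩ := hg.tendsto_cauchy_boundary x
    refine ⟨_, ?_, (((hR.sub_const (c : ℂ)).const_mul
      (1 / (Real.pi * Complex.I))).add_const (l : ℂ)).congr' ?_⟩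
    · have : (1 / (Real.pi * Complex.I) : ℂ) *
          (R + ((u x - l : ℝ) : ℂ) * (Complex.I * Real.pi) - c) + l
          = (u x : ℂ) + (((c - R) / Real.pi : ℝ) : ℂ) * Complex.I := by
        push_cast
        field_simp
        linear_combination (R - c : ℂ) * Complex.I_sq
      rw [this]
      simp
    · filter_upwards [self_mem_nhdsWithin] with z hz using (hc z hz).symm
  have hlim : ∀ z ∈ closure upper, ∃ y, Tendsto (complexSchwartz u) (𝓝[upper] z) (𝓝 y) := by
    intro z hz
    rw [closure_upper] at hz
    rcases (show 0 ≤ z.im from hz).lt_or_eq with h | h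
    · exact ⟨_, (hdiff z h).continuousWithinAt⟩
    · have hzx : z = (z.re : ℂ) := by apply Complex.ext <;> simp [← h]
      obtain ⟨y, -, hy⟩ := hbd z.re
      exact ⟨y, hzx ▸ hy⟩
  have heq : Set.EqOn (extendFrom upper (complexSchwartz u)) (complexSchwartz u) upper :=
    fun z hz => extendFrom_eq (subset_closure hz) (hdiff z hz).continuousWithinAt
  refine ⟨extendFrom upper (complexSchwartz u), heq, continuousOn_extendFrom subset_rfl hlim,
    ?_, fun x => ?_⟩
  · refine ⟨_, (((hg.tendsto_cauchy_infty.sub_const (c : ℂ)).const_mul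
      (1 / (Real.pi * Complex.I))).add_const (l : ℂ)).congr' ?_⟩
    filter_upwards [eventually_mem_upper_infty] with z hz
    rw [heq hz, hc z hz]
  · obtain ⟨y, hy, hyl⟩ := hbd x
    rw [extendFrom_eq (ofReal_mem_closure_upper x) hyl, hy]

theorem exists_solution {u₁ u₃ : ℝ → ℝ} {l₁ l₃ : ℝ}
    (hc₁ : Continuous u₁) (hc₃ : Continuous u₃)
    (hl₁ : Tendsto u₁ (cocompact ℝ) (𝓝 l₁)) (hl₃ : Tendsto u₃ (cocompact ℝ) (𝓝 l₃))
    (hd₁ : Dini (modulus u₁)) (hd₃ : Dini (modulus u₃))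
    (hi₁ : Dini (modulusInfty u₁ l₁)) (hi₃ : Dini (modulusInfty u₃ l₃)) (a₁ a₂ : ℝ) :
    ∃ Φ : BAlg → BAlg, IsSolution13 u₁ u₃ Φ ∧
      ∀ ζ ∈ halfPlane, Φ ζ = schwartz u₁ ζ * e₁ + schwartz u₃ ζ * e₂
        + (a₁ * Complex.I) • e₁ + (a₂ * Complex.I) • e₂ := by
  obtain ⟨M₁, hM₁⟩ := exists_bound_of_tendsto_cocompact hc₁ hl₁
  obtain ⟨M₃, hM₃⟩ := exists_bound_of_tendsto_cocompact hc₃ hl₃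
  have hD₁ := differentiableOn_complexSchwartz hc₁ hM₁
  have hD₃ := differentiableOn_complexSchwartz hc₃ hM₃
  obtain ⟨S₁, he₁, hS₁, ⟨L₁, hL₁⟩, hb₁⟩ := exists_continuous_extension hc₁ hl₁ hd₁ hi₁
  obtain ⟨S₃, he₃, hS₃, ⟨L₃, hL₃⟩, hb₃⟩ := exists_continuous_extension hc₃ hl₃ hd₃ hi₃
  have hDS₁ : DifferentiableOn ℂ S₁ upper := hD₁.congr he₁
  have hDS₃ : DifferentiableOn ℂ S₃ upper := hD₃.congr he₃
  -- Read off from (S₁ + ρ y S₁') + (S₃ + ρ y S₃')(i + ρ), with the imaginary constants expanded in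
  -- the same way.
  set A : ℂ → ℂ := fun z => S₁ z + S₃ z * Complex.I + (a₁ * Complex.I - a₂) with hA
  set F : ℂ → ℂ := fun z => S₃ z + a₂ * Complex.I with hF
  refine ⟨fun a => pair (A (ofPlane a)) ((ofPlane a).im * deriv A (ofPlane a) + F (ofPlane a)),
    isSolution_of_pair (A := A) (F := F) ((hDS₁.add (hDS₃.mul_const _)).add_const _)
    (hDS₃.add_const _) ((hS₁.add (hS₃.mul continuousOn_const)).add continuousOn_const)
    (hS₃.add continuousOn_const) ((hL₁.add (hL₃.mul_const _)).add_const _) (hL₃.add_const _)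
    (fun x => ?_) (fun x => ?_) (fun z _ => ?_), ?_⟩
  · simp [hA, hF, hb₁ x]
    ring
  · simp [hF, hb₃ x]
  · rw [ofPlane_toPlane]
  · rw [halfPlane_eq]
    rintro _ ⟨z, hz, rfl⟩
    have hn : upper ∈ 𝓝 z := isOpen_upper.mem_nhds hz
    have h1 : deriv A z = deriv (complexSchwartz u₁) z + deriv (complexSchwartz u₃) z * Complex.I := by
      have hev : A =ᶠ[𝓝 z] fun w => complexSchwartz u₁ w + complexSchwartz u₃ w * Complex.I
          + (a₁ * Complex.I - a₂) := by
        filter_upwards [hn] with w hw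
        simp only [hA, he₁ hw, he₃ hw]
      rw [hev.deriv_eq]
      exact (((hD₁.differentiableAt hn).hasDerivAt.add
        ((hD₃.differentiableAt hn).hasDerivAt.mul_const _)).add_const _).deriv
    rw [add_assoc, imaginary_constants, schwartz_toPlane hc₁ hM₁ hz, schwartz_toPlane hc₃ hM₃ hz,
      e₁_eq_pair, e₂_eq_pair, pair_mul, pair_mul, pair_add, pair_add]
    simp only [ofPlane_toPlane, h1]
    simp only [hA, hF, he₁ hz, he₃ hz]
    congr 1 <;> ring

end BiharmonicPlane

end

open BiharmonicPlane in
theorem theorem1 (u₁ u₃ : ℝ → ℝ) (l₁ l₃ : ℝ)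
    (hc₁ : Continuous u₁) (hc₃ : Continuous u₃)
    (hl₁ : Tendsto u₁ (cocompact ℝ) (𝓝 l₁)) (hl₃ : Tendsto u₃ (cocompact ℝ) (𝓝 l₃))
    (hd₁ : Dini (modulus u₁)) (hd₃ : Dini (modulus u₃))
    (hi₁ : Dini (modulusInfty u₁ l₁)) (hi₃ : Dini (modulusInfty u₃ l₃)) :
    -- the Schwartz integrals are well defined (they converge absolutely)
    (∀ ζ ∈ halfPlane, Integrable (schwartzIntegrand u₁ ζ) ∧ Integrable (schwartzIntegrand u₃ ζ)) ∧
    -- for all real constants the formula represents a solution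
    (∀ a₁ a₂ : ℝ, ∃ Φ : BAlg → BAlg, IsSolution13 u₁ u₃ Φ ∧
      ∀ ζ ∈ halfPlane, Φ ζ = schwartz u₁ ζ * e₁ + schwartz u₃ ζ * e₂
        + (a₁ * Complex.I) • e₁ + (a₂ * Complex.I) • e₂) ∧
    -- every solution is of this form
    (∀ Φ : BAlg → BAlg, IsSolution13 u₁ u₃ Φ → ∃ a₁ a₂ : ℝ,
      ∀ ζ ∈ halfPlane, Φ ζ = schwartz u₁ ζ * e₁ + schwartz u₃ ζ * e₂
        + (a₁ * Complex.I) • e₁ + (a₂ * Complex.I) • e₂) ∧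
    -- the solutions of the homogeneous problem are exactly the constants `a₁ i e₁ + a₂ i e₂`
    (∀ Φ : BAlg → BAlg, IsSolution13 (fun _ => 0) (fun _ => 0) Φ ↔ ∃ a₁ a₂ : ℝ,
      ∀ ζ ∈ closure halfPlane, Φ ζ = (a₁ * Complex.I) • e₁ + (a₂ * Complex.I) • e₂) := by
  obtain ⟨M₁, hM₁⟩ := exists_bound_of_tendsto_cocompact hc₁ hl₁
  obtain ⟨M₃, hM₃⟩ := exists_bound_of_tendsto_cocompact hc₃ hl₃
  have hsol := exists_solution hc₁ hc₃ hl₁ hl₃ hd₁ hd₃ hi₁ hi₃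
  refine ⟨?_, hsol, fun Φ hΦ => ?_, fun Φ => ⟨eq_const_of_isSolution_zero, ?_⟩⟩
  · rw [halfPlane_eq]
    rintro _ ⟨z, hz, rfl⟩
    exact ⟨integrable_schwartzIntegrand hc₁ hM₁ hz, integrable_schwartzIntegrand hc₃ hM₃ hz⟩
  -- Subtracting the particular solution with zero constants leaves the homogeneous problem.
  · obtain ⟨Ψ, hΨ, hΨeq⟩ := hsol 0 0
    have h0 := hΦ.sub hΨ
    simp only [sub_self] at h0
    obtain ⟨a₁, a₂, h⟩ := eq_const_of_isSolution_zero h0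
    refine ⟨a₁, a₂, fun ζ hζ => ?_⟩
    have h1 := h ζ (subset_closure hζ)
    rw [hΨeq ζ hζ] at h1
    rw [add_assoc, ← h1]
    simp
  · rintro ⟨a₁, a₂, h⟩
    exact isSolution_const h
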